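/- Let $d\ge 1$ and write $p=(p_0,\mathbf p)\in\mathbb R\times\mathbb R^{d-1}=\mathbb R^d$ and $[p,q]=p_0q_0-\mathbf p\mathbf q$. Let $\overline{V_+}=\{p: p_0\ge 0,\ [p,p]\ge 0\}$ be the closed forward light cone and $L^\uparrow=\{g\in \mathrm O_{1,d-1}(\mathbb R): g_{00}>0\}$ the orthochronous Lorentz group. For $m\ge 0$ (for $m>0$ if $d=1$) let $\mu_m$ be the Borel measure on $\mathbb R^d$ with $$\int f\,d\mu_m=\int_{\mathbb R^{d-1}} f\big(\sqrt{m^2+\mathbf p^2},\mathbf p\big)\,\frac{d\mathbf p}{\sqrt{m^2+\mathbf p^2}}.$$ A Borel measure $\kappa$ on $\mathbb R^k$, or on $[0,\infty)\subseteq\mathbb R$, is called tempered if $\int (1+\|x\|^2)^{-N}\,d\kappa(x)<\infty$ for some $N\in\mathbb N$. **Theorem.** For every $\sigma$-finite $L^\uparrow$-invariant Borel measure $\mu$ on $\overline{V_+}$ there exist a $\sigma$-finite Borel measure $\rho$ on $[0,\infty)$, with $\rho(\{0\})=0$ if $d=1$, and a constant $0\le c<\infty$ such that $$\mu=c\,\delta_0+\int_0^\infty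 \mu_m\,d\rho(m).$$ Moreover, for every such pair $(c,\rho)$ the following hold. (a) $\mu$ is tempered if and only if (C1) $\rho$ is tempered; (C2) if $d=1$, then $\int_{[0,1]}\frac1m\,d\rho(m)<\infty$; (C3) if $d=2$, then $\int_{[0,1]}\ln(m^{-1})\,d\rho(m)<\infty$, where $\ln(0^{-1})=\infty$. In particular, for $d=2$, the inequality in (C3) implies $\rho(\{0\})=0$. (b) Let $\mathrm{pr}(p_0,\mathbf p)=\mathbf p$. The measure $\tilde\mu=\mathrm{pr}_*\mu$ on $\mathbb R^{d-1}$ is tempered if and only if $\mu$ is tempered and $\int_{[1,\infty)}\frac1m\,d\rho(m)<\infty$. If $\int_{[1,\infty)}\frac1m\,d\rho(m)=\infty$, then the measure $\tilde\mu_0=\mathrm{pr}_*\int_0^\infty\mu_m\,d\rho(m)$ satisfies $\tilde\mu_0(E)\in\{0,\infty\}$ for every Borel set $E\subseteq\mathbb R^{d-1}$, and $L^2(\mathbb R^{d-1},\tilde\mu_0)=\{0\}$; if in addition $c=0$ or $d=1$, then likewise $\tilde\mu(E)\in\{0,\infty\}$ for every Borel set $E\subseteq\mathbb R^{d-1}$,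 and $L^2(\mathbb R^{d-1},\tilde\mu)=\{0\}$. -/

import Mathlib

open MeasureTheory Set
open scoped NNReal ENNReal

noncomputable section

/-- Energy-momentum space `ℝ^d` with `d = n + 1`, written as pairs `p = (p₀, 𝐩)` with `p₀ ∈ ℝ`
and `𝐩 ∈ ℝ^(d-1) = ℝ^n`; the space `ℝ^n` carries the Euclidean norm and Lebesgue measure. -/
abbrev Momentum (n : ℕ) : Type := ℝ × EuclideanSpace ℝ (Fin n)

/-- The Lorentzian scalar product `[p, q] = p₀ q₀ - 𝐩 𝐪`. -/
def lorentzForm {n : ℕ} (p q : Momentum n) : ℝ := p.1 * q.1 - inner ℝ p.2 q.2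

/-- The closed forward light cone `{p : p₀ ≥ 0, [p, p] ≥ 0}`. -/
def closedForwardCone (n : ℕ) : Set (Momentum n) :=
  {p | 0 ≤ p.1 ∧ 0 ≤ lorentzForm p p}

/-- The orthochronous Lorentz group `{g ∈ O_{1,n}(ℝ) : g₀₀ > 0}`, as a set of linear automorphisms
of `ℝ^d`; the entry `g₀₀` is the time component of `g e₀`, where `e₀ = (1, 0)`. -/
def orthochronousLorentz (n : ℕ) : Set (Momentum n ≃ₗ[ℝ] Momentum n) :=
  {g | (∀ p q, lorentzForm (g p) (g q) = lorentzForm p q) ∧ 0 < (g (1, 0)).1}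

/-- `μ` is a measure on the closed forward light cone (regarded as a measure on `ℝ^d` for which the
complement of the cone is a null set) that is invariant under the orthochronous Lorentz group. -/
def IsLorentzInvariantOnCone {n : ℕ} (μ : Measure (Momentum n)) : Prop :=
  μ (closedForwardCone n)ᶜ = 0 ∧ ∀ g ∈ orthochronousLorentz n, μ.map g = μ

/-- The measure `μ_m` on the mass shell `H_m`, given by
`∫ f dμ_m = ∫ f(√(m² + 𝐩²), 𝐩) / √(m² + 𝐩²) d𝐩`. -/
def massShellMeasure (n : ℕ) (m : ℝ≥0) : Measure (Momentum n) :=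
  ((volume : Measure (EuclideanSpace ℝ (Fin n))).withDensity
      fun x => (ENNReal.ofReal (√((m : ℝ) ^ 2 + ‖x‖ ^ 2)))⁻¹).map
    fun x => (√((m : ℝ) ^ 2 + ‖x‖ ^ 2), x)

/-- The family `m ↦ μ_m` is measurable, so that `Measure.bind` below is the honest integral. -/
theorem measurable_massShellMeasure (n : ℕ) : Measurable (massShellMeasure n) := by
  refine Measure.measurable_of_measurable_coe _ fun s hs => ?_
  have hmap : ∀ m : ℝ≥0, Measurable
      (fun x : EuclideanSpace ℝ (Fin n) => (√((m : ℝ) ^ 2 + ‖x‖ ^ 2), x)) := fun m => by fun_prop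
  have hd : Measurable (fun z : ℝ≥0 × EuclideanSpace ℝ (Fin n) =>
      (ENNReal.ofReal (√((z.1 : ℝ) ^ 2 + ‖z.2‖ ^ 2)))⁻¹) := by fun_prop
  have hj : Measurable (fun z : ℝ≥0 × EuclideanSpace ℝ (Fin n) =>
      ((√((z.1 : ℝ) ^ 2 + ‖z.2‖ ^ 2), z.2) : Momentum n)) := by fun_prop
  have key : ∀ m : ℝ≥0, massShellMeasure n m s = ∫⁻ x : EuclideanSpace ℝ (Fin n),
      ((fun z : ℝ≥0 × EuclideanSpace ℝ (Fin n) =>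
        ((√((z.1 : ℝ) ^ 2 + ‖z.2‖ ^ 2), z.2) : Momentum n)) ⁻¹' s).indicator
      (fun z => (ENNReal.ofReal (√((z.1 : ℝ) ^ 2 + ‖z.2‖ ^ 2)))⁻¹) (m, x) := by
    intro m
    rw [massShellMeasure, Measure.map_apply (hmap m) hs, withDensity_apply _ (hmap m hs),
      ← lintegral_indicator (hmap m hs)]
    rfl
  simp_rw [key]
  exact (hd.indicator (hj hs)).lintegral_prod_right'

/-- The superposition `∫_0^∞ μ_m dρ(m)`, i.e. the measure `A ↦ ∫_0^∞ μ_m(A) dρ(m)`. -/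
def massSuperposition (n : ℕ) (ρ : Measure ℝ≥0) : Measure (Momentum n) :=
  ρ.bind (massShellMeasure n)

theorem massSuperposition_apply (n : ℕ) (ρ : Measure ℝ≥0) {A : Set (Momentum n)}
    (hA : MeasurableSet A) : massSuperposition n ρ A = ∫⁻ m, massShellMeasure n m A ∂ρ :=
  Measure.bind_apply hA (measurable_massShellMeasure n).aemeasurable

/-- `μ = c δ₀ + ∫_0^∞ μ_m dρ(m)` with a `σ`-finite Borel measure `ρ` on `[0, ∞[`, where
`ρ({0}) = 0` for `d = 1`. -/
def IsSpectralRepresentation {n : ℕ} (μ : Measure (Momentum n)) (c : ℝ≥0) (ρ : Measure ℝ≥0) :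
    Prop :=
  SigmaFinite ρ ∧ (n = 0 → ρ {0} = 0) ∧ μ = c • Measure.dirac 0 + massSuperposition n ρ

/-- A Borel measure on `[0, ∞[` is tempered if it is tempered as a measure on `ℝ`. -/
def IsTemperedOnHalfLine (ρ : Measure ℝ≥0) : Prop :=
  (ρ.map ((↑) : ℝ≥0 → ℝ)).HasTemperateGrowth

/-- The image of a measure on `ℝ^d` under the projection `pr(p₀, 𝐩) = 𝐩` to `ℝ^(d-1)`. -/
def spatialProjection {n : ℕ} (μ : Measure (Momentum n)) :
    Measure (EuclideanSpace ℝ (Fin n)) :=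
  μ.map Prod.snd

/-- Every Borel set has measure `0` or `∞`, and the (complex) `L²`-space is `{0}`. -/
def IsZeroInftyWithTrivialL2 {X : Type*} [MeasurableSpace X] (κ : Measure X) : Prop :=
  (∀ E : Set X, MeasurableSet E → κ E = 0 ∨ κ E = ∞) ∧ ∀ f : Lp ℂ 2 κ, f = 0

end

/-! Existence. For `d ≥ 2` use light-cone coordinates `(u, v, y) = (p₀ + p₁, p₀ - p₁, y)`. The part
`{u > 0}` of the cone is parametrized by the mass `m`, the rapidity `s = ln u` and the transversal
momentum `y`. Null rotations fix `m` and `s` and translate `y` by `e^s w`; boosts fix `m` and `y`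
and translate `s`. A `σ`-finite measure invariant under translations of one factor is a product with
Lebesgue measure there (`exists_eq_prod_of_translation_invariant`), so the measure on `{u > 0}` is
`ρ ⊗ ds ⊗ dy`. By the substitution `lintegral_hyperbola` this is also what `∫ μ_m dρ(m)` looks like
on `{u > 0}`. The reflection `u ↔ v` carries the equality to the rest of the cone except the origin,
which contributes `c δ₀`. For `d = 1` the shells are points and `ρ` is written down directly.

Temperedness. By Tonelli, `μ` is tempered iff `shellIntegral n N` is `ρ`-integrable for some `N`.
For large `m` it is squeezed between negative powers of `1 + m`. As `m → 0` it behaves like `1 / m`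
if `n = 0`, like `ln (1 / m)` if `n = 1`, and stays bounded for large `N` if `n ≥ 2`. For the
projected measure the weight sees only `𝐩`, so for large `m` the integral is comparable to `1 / m`,
which is the additional condition in (b).

Divergence. The projection of `∫ μ_m dρ(m)` has Lebesgue density `∫ (m² + 𝐩²)^(-1/2) dρ(m)`. If `1 /
m` is not integrable at infinity, this is infinite at every `𝐩`. -/

noncomputable section

/-- The energy `√(m² + 𝐩²)` of a particle of mass `m` and momentum `𝐩`. -/
def shellEnergy {n : ℕ} (m : ℝ≥0) (x : EuclideanSpace ℝ (Fin n)) : ℝ := √((m : ℝ) ^ 2 + ‖x‖ ^ 2)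

/-- The density `1 / √(m² + 𝐩²)` of `μ_m`. -/
def shellDensity {n : ℕ} (m : ℝ≥0) (x : EuclideanSpace ℝ (Fin n)) : ℝ≥0∞ :=
  (ENNReal.ofReal (shellEnergy m x))⁻¹

/-- The weight `1 / (1 + r)`, as an extended nonnegative real. -/
def invOneAdd (r : ℝ) : ℝ≥0∞ := (ENNReal.ofReal (1 + r))⁻¹

/-- The integral of `(1 + p₀)^(-N)` with respect to `μ_m`. -/
def shellIntegral (n N : ℕ) (m : ℝ≥0) : ℝ≥0∞ :=
  ∫⁻ x : EuclideanSpace ℝ (Fin n), shellDensity m x * invOneAdd (shellEnergy m x) ^ N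

/-- The integral of `(1 + ‖𝐩‖)^(-N)` with respect to `μ_m`. -/
def spatialIntegral (n N : ℕ) (m : ℝ≥0) : ℝ≥0∞ :=
  ∫⁻ x : EuclideanSpace ℝ (Fin n), shellDensity m x * invOneAdd ‖x‖ ^ N

/-! ### Pointwise bounds on the energy, the density and the weights -/

section Basic

variable {n : ℕ} (m : ℝ≥0) (x : EuclideanSpace ℝ (Fin n))

theorem shellEnergy_nonneg : 0 ≤ shellEnergy m x := Real.sqrt_nonneg _

theorem mass_le_shellEnergy : (m : ℝ) ≤ shellEnergy m x :=
  Real.le_sqrt_of_sq_le (by nlinarith [sq_nonneg ‖x‖])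

theorem norm_le_shellEnergy : ‖x‖ ≤ shellEnergy m x :=
  Real.le_sqrt_of_sq_le (by nlinarith [sq_nonneg (m : ℝ)])

theorem shellEnergy_le : shellEnergy m x ≤ m + ‖x‖ :=
  Real.sqrt_le_iff.2 ⟨by positivity, by nlinarith [mul_nonneg m.coe_nonneg (norm_nonneg x)]⟩

theorem shellDensity_le_inv_mass : shellDensity m x ≤ (m : ℝ≥0∞)⁻¹ := by
  refine ENNReal.inv_le_inv.2 ?_
  rw [← ENNReal.ofReal_coe_nnreal]
  exact ENNReal.ofReal_le_ofReal (mass_le_shellEnergy m x)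

theorem shellDensity_le_inv_norm : shellDensity m x ≤ (ENNReal.ofReal ‖x‖)⁻¹ :=
  ENNReal.inv_le_inv.2 (ENNReal.ofReal_le_ofReal (norm_le_shellEnergy m x))

theorem inv_le_shellDensity : (ENNReal.ofReal (m + ‖x‖))⁻¹ ≤ shellDensity m x :=
  ENNReal.inv_le_inv.2 (ENNReal.ofReal_le_ofReal (shellEnergy_le m x))

theorem measurable_shellEnergy : Measurable (shellEnergy (n := n) m) := by
  unfold shellEnergy; fun_prop

theorem measurable_shellDensity : Measurable (shellDensity (n := n) m) :=
  (measurable_shellEnergy m).ennreal_ofReal.inv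

theorem measurable_uncurry_shellDensity :
    Measurable (Function.uncurry (shellDensity (n := n))) := by
  unfold Function.uncurry shellDensity shellEnergy; fun_prop

end Basic

theorem measurable_invOneAdd : Measurable invOneAdd := by
  unfold invOneAdd; fun_prop

theorem measurable_invOneAdd_norm_pow {E : Type*} [NormedAddCommGroup E] [MeasurableSpace E]
    [OpensMeasurableSpace E] (N : ℕ) : Measurable fun x : E => invOneAdd ‖x‖ ^ N :=
  (measurable_invOneAdd.comp measurable_norm).pow_const N

theorem invOneAdd_anti {r s : ℝ} (h : r ≤ s) : invOneAdd s ≤ invOneAdd r :=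
  ENNReal.inv_le_inv.2 (ENNReal.ofReal_le_ofReal (by linarith))

theorem invOneAdd_le_one {r : ℝ} (h : 0 ≤ r) : invOneAdd r ≤ 1 := by
  refine (invOneAdd_anti h).trans ?_
  simp [invOneAdd]

theorem invOneAdd_pow_anti {r : ℝ} (h : 0 ≤ r) {M N : ℕ} (hMN : M ≤ N) :
    invOneAdd r ^ N ≤ invOneAdd r ^ M :=
  pow_le_pow_right_of_le_one' (invOneAdd_le_one h) hMN

/-- If `1 + s ≤ C (1 + r)` then `(1 + r)⁻¹ ≤ C (1 + s)⁻¹`, in the form used for lower bounds. -/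
theorem invOneAdd_mul_le {r s C : ℝ} (hC : 0 < C) (h : 1 + s ≤ C * (1 + r)) :
    (ENNReal.ofReal C)⁻¹ * invOneAdd r ≤ invOneAdd s := by
  unfold invOneAdd
  rw [← ENNReal.mul_inv (Or.inr ENNReal.ofReal_ne_top) (Or.inl ENNReal.ofReal_ne_top),
    ← ENNReal.ofReal_mul hC.le]
  exact ENNReal.inv_le_inv.2 (ENNReal.ofReal_le_ofReal h)

theorem ofReal_one_add_rpow_neg {r : ℝ} (h : 0 ≤ r) (N : ℕ) :
    ENNReal.ofReal ((1 + r) ^ (-(N : ℝ))) = invOneAdd r ^ N := by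
  rw [Real.rpow_neg (by positivity), Real.rpow_natCast, ENNReal.ofReal_inv_of_pos (by positivity),
    ENNReal.ofReal_pow (by positivity), invOneAdd, ENNReal.inv_pow]

theorem hasTemperateGrowth_iff {E : Type*} [NormedAddCommGroup E] [MeasurableSpace E]
    [OpensMeasurableSpace E] (μ : Measure E) :
    μ.HasTemperateGrowth ↔ ∃ N : ℕ, ∫⁻ x, invOneAdd ‖x‖ ^ N ∂μ < ∞ := by
  have key : ∀ N : ℕ, Integrable (fun x : E => (1 + ‖x‖) ^ (-(N : ℝ))) μ ↔
      ∫⁻ x, invOneAdd ‖x‖ ^ N ∂μ < ∞ := by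
    intro N
    have hm : Measurable fun x : E => (1 + ‖x‖) ^ (-(N : ℝ)) := by fun_prop
    rw [Integrable, and_iff_right hm.aestronglyMeasurable, hasFiniteIntegral_iff_ofReal
      (.of_forall fun x => by positivity)]
    simp_rw [ofReal_one_add_rpow_neg (norm_nonneg _)]
  exact ⟨fun h => h.exists_integrable.imp fun N => (key N).1,
    fun ⟨N, h⟩ => ⟨⟨N, (key N).2 h⟩⟩⟩

theorem isTemperedOnHalfLine_iff (ρ : Measure ℝ≥0) :
    IsTemperedOnHalfLine ρ ↔ ∃ N : ℕ, ∫⁻ m, invOneAdd m ^ N ∂ρ < ∞ := by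
  rw [IsTemperedOnHalfLine, hasTemperateGrowth_iff]
  refine exists_congr fun N => ?_
  rw [lintegral_map (measurable_invOneAdd_norm_pow N)
    measurable_coe_nnreal_real]
  simp

theorem lintegral_invOneAdd_norm_finrank_lt_top {E : Type*} [NormedAddCommGroup E]
    [NormedSpace ℝ E] [FiniteDimensional ℝ E] [MeasurableSpace E] [BorelSpace E] (μ : Measure E)
    [μ.IsAddHaarMeasure] : ∫⁻ x, invOneAdd ‖x‖ ^ (Module.finrank ℝ E + 1) ∂μ < ∞ := by
  have h := integrable_one_add_norm (μ := μ) (r := ((Module.finrank ℝ E + 1 : ℕ) : ℝ)) (by simp)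
  simpa only [ofReal_one_add_rpow_neg (norm_nonneg _)] using
    (hasFiniteIntegral_iff_ofReal (.of_forall fun x => by positivity)).1 h.2

theorem lintegral_invOneAdd_norm_lt_top (n : ℕ) :
    ∫⁻ x : EuclideanSpace ℝ (Fin n), invOneAdd ‖x‖ ^ (n + 1) < ∞ := by
  simpa using lintegral_invOneAdd_norm_finrank_lt_top
    (volume : Measure (EuclideanSpace ℝ (Fin n)))

theorem lintegral_massShellMeasure {n : ℕ} (m : ℝ≥0) {f : Momentum n → ℝ≥0∞} (hf : Measurable f) :
    ∫⁻ p, f p ∂(massShellMeasure n m) = ∫⁻ x, shellDensity m x * f (shellEnergy m x, x) := by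
  rw [massShellMeasure, lintegral_map hf (by fun_prop)]
  exact lintegral_withDensity_eq_lintegral_mul _ (measurable_shellDensity m)
    (hf.comp ((measurable_shellEnergy m).prodMk measurable_id))

theorem lintegral_massSuperposition {n : ℕ} (ρ : Measure ℝ≥0) {f : Momentum n → ℝ≥0∞}
    (hf : Measurable f) :
    ∫⁻ p, f p ∂(massSuperposition n ρ) =
      ∫⁻ m, (∫⁻ x, shellDensity m x * f (shellEnergy m x, x)) ∂ρ := by
  rw [massSuperposition, Measure.lintegral_bind (measurable_massShellMeasure n).aemeasurable
    hf.aemeasurable]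
  simp_rw [lintegral_massShellMeasure _ hf]

/-! ### Temperedness as finiteness of an iterated integral -/

section Representation

variable {n : ℕ} {μ : Measure (Momentum n)} {c : ℝ≥0} {ρ : Measure ℝ≥0}

/-- The atom contributes the finite amount `c f(0)`, so only the superposition decides. -/
theorem IsSpectralRepresentation.lintegral_lt_top_iff (h : IsSpectralRepresentation μ c ρ)
    {f : Momentum n → ℝ≥0∞} (hf : Measurable f) (hf0 : f 0 ≠ ∞) :
    ∫⁻ p, f p ∂μ < ∞ ↔ ∫⁻ m, (∫⁻ x, shellDensity m x * f (shellEnergy m x, x)) ∂ρ < ∞ := by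
  rw [h.2.2, lintegral_add_measure, lintegral_smul_measure, lintegral_dirac' _ hf,
    lintegral_massSuperposition ρ hf, ENNReal.add_lt_top]
  exact and_iff_right (ENNReal.mul_lt_top ENNReal.coe_lt_top hf0.lt_top)

theorem IsSpectralRepresentation.hasTemperateGrowth_iff (h : IsSpectralRepresentation μ c ρ) :
    μ.HasTemperateGrowth ↔ ∃ N, ∫⁻ m, shellIntegral n N m ∂ρ < ∞ := by
  rw [_root_.hasTemperateGrowth_iff]
  refine exists_congr fun N => ?_
  rw [h.lintegral_lt_top_iff (measurable_invOneAdd_norm_pow N)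
    (by simp [invOneAdd])]
  -- `Momentum n` carries the sup norm, and `‖𝐩‖ ≤ p₀` on the shell.
  have : ∀ (m : ℝ≥0) (x : EuclideanSpace ℝ (Fin n)),
      ‖((shellEnergy m x, x) : Momentum n)‖ = shellEnergy m x := fun m x => by
    rw [Prod.norm_mk, Real.norm_of_nonneg (shellEnergy_nonneg m x),
      max_eq_left (norm_le_shellEnergy m x)]
  simp only [this, shellIntegral]

theorem IsSpectralRepresentation.hasTemperateGrowth_spatialProjection_iff
    (h : IsSpectralRepresentation μ c ρ) :
    (spatialProjection μ).HasTemperateGrowth ↔ ∃ N, ∫⁻ m, spatialIntegral n N m ∂ρ < ∞ := by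
  rw [_root_.hasTemperateGrowth_iff]
  refine exists_congr fun N => ?_
  have hm : Measurable fun p : Momentum n => invOneAdd ‖p.2‖ ^ N :=
    (measurable_invOneAdd_norm_pow N).comp measurable_snd
  rw [spatialProjection, lintegral_map (measurable_invOneAdd_norm_pow N) measurable_snd,
    h.lintegral_lt_top_iff hm (by simp [invOneAdd])]
  rfl

end Representation

/-! ### Bounds on `shellIntegral` in terms of the mass -/

section Estimates

/-- On the unit ball the energy is at most `1 + m`; the density then supplies one factor `1 / (1 +
m)` beyond the `N` from the weight. -/
theorem le_shellIntegral (n N : ℕ) (m : ℝ≥0) :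
    (2⁻¹ : ℝ≥0∞) ^ N * volume (Metric.closedBall (0 : EuclideanSpace ℝ (Fin n)) 1) *
      invOneAdd m ^ (N + 1) ≤ shellIntegral n N m := by
  refine le_trans ?_ (setLIntegral_le_lintegral (Metric.closedBall 0 1) _)
  refine le_trans (le_of_eq ?_) (setLIntegral_mono' (f := fun _ => 2⁻¹ ^ N * invOneAdd m ^ (N + 1))
    Metric.isClosed_closedBall.measurableSet fun x hx => ?_)
  · rw [setLIntegral_const]; ring
  · have hx : ‖x‖ ≤ 1 := by simpa using hx
    have h1 : invOneAdd m ≤ shellDensity m x := by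
      refine le_trans ?_ (inv_le_shellDensity m x)
      exact ENNReal.inv_le_inv.2 (ENNReal.ofReal_le_ofReal (by linarith))
    have h2 : 2⁻¹ * invOneAdd m ≤ invOneAdd (shellEnergy m x) := by
      simpa using invOneAdd_mul_le (r := m) (s := shellEnergy m x) (C := 2) (by norm_num)
        (by linarith [shellEnergy_le m x, m.coe_nonneg])
    calc 2⁻¹ ^ N * invOneAdd m ^ (N + 1) = invOneAdd m * (2⁻¹ * invOneAdd m) ^ N := by ring
      _ ≤ _ := mul_le_mul' h1 (pow_le_pow_left' h2 N)

/-- The energy dominates both `m` and `‖x‖`, so half of the exponent buys decay in each and the two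
variables separate. -/
theorem invOneAdd_shellEnergy_pow_le {n : ℕ} (N : ℕ) (m : ℝ≥0) (x : EuclideanSpace ℝ (Fin n)) :
    invOneAdd (shellEnergy m x) ^ (2 * N) ≤ invOneAdd m ^ N * invOneAdd ‖x‖ ^ N := by
  rw [two_mul, pow_add]
  exact mul_le_mul' (pow_le_pow_left' (invOneAdd_anti (mass_le_shellEnergy m x)) N)
    (pow_le_pow_left' (invOneAdd_anti (norm_le_shellEnergy m x)) N)

theorem shellIntegral_le_of_one_le (n N : ℕ) {m : ℝ≥0} (hm : 1 ≤ m) :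
    shellIntegral n (2 * N) m ≤
      (∫⁻ x : EuclideanSpace ℝ (Fin n), invOneAdd ‖x‖ ^ N) * invOneAdd m ^ N := by
  have hmeas := measurable_invOneAdd_norm_pow (E := EuclideanSpace ℝ (Fin n)) N
  rw [mul_comm (lintegral _ _), ← lintegral_const_mul _ hmeas]
  refine lintegral_mono fun x => ?_
  have h1 : shellDensity m x ≤ 1 :=
    (shellDensity_le_inv_mass m x).trans (by simpa using hm)
  calc _ ≤ 1 * _ := mul_le_mul' h1 (invOneAdd_shellEnergy_pow_le N m x)
    _ = _ := one_mul _

/-- A bound uniform down to `m = 0`; its constant is finite only where `1 / ‖x‖` is locally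
integrable, that is for `n ≥ 2`. -/
theorem shellIntegral_le (n N : ℕ) (m : ℝ≥0) :
    shellIntegral n (2 * N) m ≤ (∫⁻ x : EuclideanSpace ℝ (Fin n),
      (ENNReal.ofReal ‖x‖)⁻¹ * invOneAdd ‖x‖ ^ N) * invOneAdd m ^ N := by
  have hmeas := measurable_invOneAdd_norm_pow (E := EuclideanSpace ℝ (Fin n)) N
  rw [mul_comm (lintegral _ _), ← lintegral_const_mul _ (by fun_prop)]
  refine lintegral_mono fun x => ?_
  calc _ ≤ (ENNReal.ofReal ‖x‖)⁻¹ * (invOneAdd m ^ N * invOneAdd ‖x‖ ^ N) :=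
        mul_le_mul' (shellDensity_le_inv_norm m x) (invOneAdd_shellEnergy_pow_le N m x)
    _ = _ := by ring

theorem shellIntegral_mono (n : ℕ) {M N : ℕ} (h : M ≤ N) (m : ℝ≥0) :
    shellIntegral n N m ≤ shellIntegral n M m :=
  lintegral_mono fun x =>
    mul_le_mul' le_rfl (invOneAdd_pow_anti (shellEnergy_nonneg m x) h)

/-- In polar coordinates the Jacobian `y^(n-1)` absorbs the pole, leaving an integrand at most `(1 +
y)^(-3)`. -/
theorem lintegral_inv_norm_mul_invOneAdd_lt_top {n : ℕ} (hn : 2 ≤ n) :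
    ∫⁻ x : EuclideanSpace ℝ (Fin n), (ENNReal.ofReal ‖x‖)⁻¹ * invOneAdd ‖x‖ ^ (n + 1) < ∞ := by
  have : Nontrivial (EuclideanSpace ℝ (Fin n)) := by
    have : Nonempty (Fin n) := ⟨⟨0, by lia⟩⟩
    infer_instance
  have hint : Integrable
      (fun x : EuclideanSpace ℝ (Fin n) => ‖x‖⁻¹ * (1 + ‖x‖) ^ (-((n + 1 : ℕ) : ℝ))) := by
    rw [integrable_fun_norm_addHaar volume (f := fun y => y⁻¹ * (1 + y) ^ (-((n + 1 : ℕ) : ℝ)))]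
    have h3 := (integrable_one_add_norm (E := ℝ) (μ := volume) (r := ((3 : ℕ) : ℝ))
      (by norm_num)).integrableOn (s := Ioi 0)
    refine h3.mono' (by fun_prop) ?_
    filter_upwards [ae_restrict_mem measurableSet_Ioi] with y (hy : 0 < y)
    obtain ⟨k, rfl⟩ := Nat.exists_eq_add_of_le hn
    simp only [finrank_euclideanSpace, Fintype.card_fin, smul_eq_mul, Real.norm_eq_abs,
      abs_of_pos hy]
    rw [abs_of_nonneg (by positivity), Real.rpow_neg (by positivity), Real.rpow_neg (by positivity),
      Real.rpow_natCast, Real.rpow_natCast, show 2 + k - 1 = k + 1 by lia, pow_succ,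
      show 2 + k + 1 = k + 3 by lia, pow_add (1 + y)]
    have h4 : y ^ k ≤ (1 + y) ^ k := by gcongr; linarith
    calc y ^ k * y * (y⁻¹ * ((1 + y) ^ k * (1 + y) ^ 3)⁻¹)
        = y ^ k / (1 + y) ^ k * ((1 + y) ^ 3)⁻¹ := by field_simp
      _ ≤ 1 * ((1 + y) ^ 3)⁻¹ := by gcongr; exact div_le_one_of_le₀ h4 (by positivity)
      _ = _ := one_mul _
  refine lt_of_eq_of_lt (lintegral_congr_ae ?_)
    ((hasFiniteIntegral_iff_ofReal (.of_forall fun x => by positivity)).1 hint.2)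
  filter_upwards [Measure.ae_ne volume (0 : EuclideanSpace ℝ (Fin n))] with x hx
  rw [ENNReal.ofReal_mul (by positivity), ofReal_one_add_rpow_neg (norm_nonneg _),
    ENNReal.ofReal_inv_of_pos (norm_pos_iff.2 hx)]

end Estimates

/-! ### Bounds on `spatialIntegral`: order `1 / m` for large mass -/

section SpatialEstimates

theorem shellIntegral_le_spatialIntegral (n N : ℕ) (m : ℝ≥0) :
    shellIntegral n N m ≤ spatialIntegral n N m :=
  lintegral_mono fun x => mul_le_mul' le_rfl
    (pow_le_pow_left' (invOneAdd_anti (norm_le_shellEnergy m x)) N)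

theorem spatialIntegral_mono (n : ℕ) {M N : ℕ} (h : M ≤ N) (m : ℝ≥0) :
    spatialIntegral n N m ≤ spatialIntegral n M m :=
  lintegral_mono fun x => mul_le_mul' le_rfl (invOneAdd_pow_anti (norm_nonneg x) h)

theorem le_spatialIntegral (n N : ℕ) {m : ℝ≥0} (hm : 1 ≤ m) :
    (2⁻¹ : ℝ≥0∞) ^ (N + 1) * volume (Metric.closedBall (0 : EuclideanSpace ℝ (Fin n)) 1) *
      (m : ℝ≥0∞)⁻¹ ≤ spatialIntegral n N m := by
  have hm' : (1 : ℝ) ≤ m := hm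
  refine le_trans ?_ (setLIntegral_le_lintegral (Metric.closedBall 0 1) _)
  refine le_trans (le_of_eq ?_) (setLIntegral_mono' (f := fun _ => 2⁻¹ ^ (N + 1) * (m : ℝ≥0∞)⁻¹)
    Metric.isClosed_closedBall.measurableSet fun x hx => ?_)
  · rw [setLIntegral_const]; ring
  · have hx : ‖x‖ ≤ 1 := by simpa using hx
    have h1 : 2⁻¹ * (m : ℝ≥0∞)⁻¹ ≤ shellDensity m x := by
      refine le_trans (le_of_eq ?_) ((ENNReal.inv_le_inv.2 (ENNReal.ofReal_le_ofReal
        (show (m : ℝ) + ‖x‖ ≤ 2 * m by linarith))).trans (inv_le_shellDensity m x))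
      rw [ENNReal.ofReal_mul (by norm_num), ENNReal.ofReal_coe_nnreal,
        ENNReal.mul_inv (by simp) (by simp)]
      simp
    have h2 : 2⁻¹ ≤ invOneAdd ‖x‖ := by
      simpa [invOneAdd] using invOneAdd_mul_le (r := 0) (s := ‖x‖) (C := 2) (by norm_num)
        (by linarith)
    calc 2⁻¹ ^ (N + 1) * (m : ℝ≥0∞)⁻¹ = (2⁻¹ * (m : ℝ≥0∞)⁻¹) * 2⁻¹ ^ N := by ring
      _ ≤ _ := mul_le_mul' h1 (pow_le_pow_left' h2 N)

theorem spatialIntegral_le (n N : ℕ) (m : ℝ≥0) :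
    spatialIntegral n N m ≤
      (∫⁻ x : EuclideanSpace ℝ (Fin n), invOneAdd ‖x‖ ^ N) * (m : ℝ≥0∞)⁻¹ := by
  rw [mul_comm (lintegral _ _), ← lintegral_const_mul _ (measurable_invOneAdd_norm_pow N)]
  exact lintegral_mono fun x => mul_le_mul' (shellDensity_le_inv_mass m x) le_rfl

/-- For `m ≤ 1` the two weights are comparable, since `1 + p₀ ≤ 2 (1 + ‖𝐩‖)`. -/
theorem spatialIntegral_le_of_le_one (n N : ℕ) {m : ℝ≥0} (hm : m ≤ 1) :
    spatialIntegral n N m ≤ 2 ^ N * shellIntegral n N m := by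
  have hm' : (m : ℝ) ≤ 1 := hm
  rw [shellIntegral, ← lintegral_const_mul' _ _ (by finiteness)]
  refine lintegral_mono fun x => ?_
  have h2 : invOneAdd ‖x‖ ≤ 2 * invOneAdd (shellEnergy m x) := by
    have := invOneAdd_mul_le (r := ‖x‖) (s := shellEnergy m x) (C := 2) (by norm_num)
        (by linarith [shellEnergy_le m x, norm_nonneg x])
    rwa [ENNReal.inv_mul_le_iff (by simp) (by simp), show ENNReal.ofReal 2 = 2 by simp] at this
  calc _ ≤ shellDensity m x * (2 * invOneAdd (shellEnergy m x)) ^ N :=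
        mul_le_mul' le_rfl (pow_le_pow_left' h2 N)
    _ = _ := by rw [mul_pow]; ring

end SpatialEstimates

/-! ### The case `d = 1`: momentum space is a point -/

section DimensionOne

theorem shellIntegral_zero (N : ℕ) (m : ℝ≥0) :
    shellIntegral 0 N m = (m : ℝ≥0∞)⁻¹ * invOneAdd m ^ N := by
  have hE : ∀ x : EuclideanSpace ℝ (Fin 0), shellEnergy m x = m := fun x => by
    simp [shellEnergy, Subsingleton.elim x 0]
  have hv : (volume : Measure (EuclideanSpace ℝ (Fin 0))) univ = 1 := by
    rw [volume_euclideanSpace_eq_dirac]; simp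
  simp [shellIntegral, shellDensity, hE, hv]

end DimensionOne

/-! ### The case `d = 2`: logarithmic divergence at small mass -/

section DimensionTwo

theorem lintegral_norm_euclideanSpace_one {f : ℝ → ℝ≥0∞} (hf : Measurable f) :
    ∫⁻ x : EuclideanSpace ℝ (Fin 1), f ‖x‖ = ∫⁻ t : ℝ, f |t| := by
  rw [← ((volume_preserving_funUnique (Fin 1) ℝ).comp
    (PiLp.volume_preserving_ofLp (Fin 1))).lintegral_comp (f := fun t => f |t|)
    (hf.comp measurable_norm)]
  refine lintegral_congr fun x => ?_
  simp [EuclideanSpace.norm_eq, Real.sqrt_sq_eq_abs]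

theorem toENNReal_log_inv {m : ℝ≥0} (hm : 0 < m) :
    (ENNReal.log (m : ℝ≥0∞)⁻¹).toENNReal = ENNReal.ofReal (-Real.log m) := by
  rw [← ENNReal.coe_inv hm.ne', ENNReal.log_pos_real' (by simpa using hm)]
  simp [Real.log_inv]

/-- For `m > 0` the integral is `ln ((m + 1) / m) ≥ ln (1 / m)`. -/
theorem toENNReal_log_inv_le {m : ℝ≥0} :
    (ENNReal.log (m : ℝ≥0∞)⁻¹).toENNReal ≤ ∫⁻ t in Ioc (0 : ℝ) 1, (ENNReal.ofReal (m + t))⁻¹ := by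
  have hpos : ∀ m : ℝ≥0, 0 < m → (ENNReal.log (m : ℝ≥0∞)⁻¹).toENNReal ≤
      ∫⁻ t in Ioc (0 : ℝ) 1, (ENNReal.ofReal (m + t))⁻¹ := by
    intro m hm
    have hm' : (0 : ℝ) < m := hm
    have hint : ∫ t in (0 : ℝ)..1, (m + t)⁻¹ = Real.log ((m + 1) / m) := by
      rw [intervalIntegral.integral_comp_add_left (fun t => t⁻¹), add_zero,
        integral_inv_of_pos hm' (by linarith)]
    have hI : IntegrableOn (fun t : ℝ => ((m : ℝ) + t)⁻¹) (Ioc 0 1) := by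
      refine (ContinuousOn.integrableOn_Icc ?_).mono_set Ioc_subset_Icc_self
      exact ContinuousOn.inv₀ (by fun_prop) fun t ht => by linarith [ht.1]
    rw [toENNReal_log_inv hm]
    calc ENNReal.ofReal (-Real.log m) ≤ ENNReal.ofReal (Real.log ((m + 1) / m)) := by
          refine ENNReal.ofReal_le_ofReal ?_
          rw [Real.log_div (by linarith) hm'.ne']
          linarith [Real.log_nonneg (show (1 : ℝ) ≤ m + 1 by linarith)]
      _ = ∫⁻ t in Ioc (0 : ℝ) 1, ENNReal.ofReal ((m + t)⁻¹) := by
          rw [← hint, intervalIntegral.integral_of_le zero_le_one,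
            ofReal_integral_eq_lintegral_ofReal hI]
          filter_upwards [ae_restrict_mem measurableSet_Ioc] with t ht
          have := ht.1
          positivity
      _ = _ := setLIntegral_congr_fun measurableSet_Ioc fun t ht =>
          ENNReal.ofReal_inv_of_pos (by linarith [ht.1])
  rcases eq_zero_or_pos m with rfl | hm
  -- The integral at `m = 0` dominates the one at mass `e^(-r)`, which is at least `r`; and `r` is
  -- arbitrary.
  · refine le_of_le_of_eq le_top (Eq.symm <| ENNReal.eq_top_of_forall_nnreal_le fun r => ?_)
    have he : (0 : ℝ≥0) < ⟨Real.exp (-r), (Real.exp_pos _).le⟩ := Real.exp_pos _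
    have h := hpos _ he
    rw [toENNReal_log_inv he] at h
    replace h : ENNReal.ofReal (-Real.log (Real.exp (-r))) ≤
      ∫⁻ t in Ioc (0 : ℝ) 1, (ENNReal.ofReal (Real.exp (-r) + t))⁻¹ := h
    rw [Real.log_exp, neg_neg, ENNReal.ofReal_coe_nnreal] at h
    refine h.trans (lintegral_mono fun t => ENNReal.inv_le_inv.2 (ENNReal.ofReal_le_ofReal ?_))
    simp [(Real.exp_pos _).le]
  · exact hpos m hm

theorem lintegral_Ioc_inv_le {m : ℝ≥0} (hm1 : m ≤ 1) :
    ∫⁻ t in Ioc (m : ℝ) 1, (ENNReal.ofReal t)⁻¹ ≤ (ENNReal.log (m : ℝ≥0∞)⁻¹).toENNReal := by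
  rcases eq_zero_or_pos m with rfl | hm
  · simp
  have hm' : (0 : ℝ) < m := hm
  have hm1' : (m : ℝ) ≤ 1 := hm1
  have hI : IntegrableOn (fun t : ℝ => t⁻¹) (Ioc m 1) := by
    refine (ContinuousOn.integrableOn_Icc ?_).mono_set Ioc_subset_Icc_self
    exact ContinuousOn.inv₀ (by fun_prop) fun t ht => by linarith [ht.1]
  have h : ∫⁻ t in Ioc (m : ℝ) 1, (ENNReal.ofReal t)⁻¹ =
      ∫⁻ t in Ioc (m : ℝ) 1, ENNReal.ofReal t⁻¹ :=
    setLIntegral_congr_fun measurableSet_Ioc fun t ht =>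
      (ENNReal.ofReal_inv_of_pos (by linarith [ht.1])).symm
  rw [h, toENNReal_log_inv hm, ← ofReal_integral_eq_lintegral_ofReal hI,
    ← intervalIntegral.integral_of_le hm1', integral_inv_of_pos hm' zero_lt_one, one_div,
    Real.log_inv]
  filter_upwards [ae_restrict_mem measurableSet_Ioc] with t ht
  have := hm'.trans ht.1
  positivity

theorem le_shellIntegral_one (N : ℕ) {m : ℝ≥0} (hm : m ≤ 1) :
    (3⁻¹ : ℝ≥0∞) ^ N * (ENNReal.log (m : ℝ≥0∞)⁻¹).toENNReal ≤ shellIntegral 1 N m := by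
  have hm' : (m : ℝ) ≤ 1 := hm
  set g : ℝ → ℝ≥0∞ := (Ioc (0 : ℝ) 1).indicator fun t => 3⁻¹ ^ N * (ENNReal.ofReal (m + t))⁻¹
    with hg
  have hgm : Measurable g := Measurable.indicator (by fun_prop) measurableSet_Ioc
  calc _ ≤ (3⁻¹ : ℝ≥0∞) ^ N * ∫⁻ t in Ioc (0 : ℝ) 1, (ENNReal.ofReal (m + t))⁻¹ :=
        mul_le_mul' le_rfl toENNReal_log_inv_le
    _ = ∫⁻ t, g t := by
        rw [← lintegral_const_mul _ (by fun_prop), hg, lintegral_indicator measurableSet_Ioc]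
    _ ≤ ∫⁻ t, g |t| := by
        refine lintegral_mono fun t => ?_
        by_cases ht : 0 < t
        · rw [abs_of_pos ht]
        · simp [hg, ht]
    _ = ∫⁻ x : EuclideanSpace ℝ (Fin 1), g ‖x‖ := (lintegral_norm_euclideanSpace_one hgm).symm
    _ ≤ _ := by
        refine lintegral_mono fun x => ?_
        by_cases hx : ‖x‖ ∈ Ioc (0 : ℝ) 1
        swap
        · simp only [hg, indicator_of_notMem hx, zero_le]
        simp only [hg, indicator_of_mem hx]
        -- With `m ≤ 1` and `‖x‖ ≤ 1` the energy is at most `2`.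
        have h2 : 3⁻¹ ≤ invOneAdd (shellEnergy m x) := by
          simpa [invOneAdd] using invOneAdd_mul_le (r := 0) (s := shellEnergy m x) (C := 3)
            (by norm_num) (by linarith [shellEnergy_le m x, hx.2])
        rw [mul_comm]
        exact mul_le_mul' (inv_le_shellDensity m x) (pow_le_pow_left' h2 N)

/-- The line is cut at `|t| = m` and `|t| = 1`. The density is at most `1 / m` on the inner interval
of length `2 m`, at most `1 / |t|` in the middle, and at most `1` outside, where the weight is
integrable. -/
theorem shellIntegral_one_le {m : ℝ≥0} (hm : m ≤ 1) :
    shellIntegral 1 2 m ≤ 2 + 2 * (ENNReal.log (m : ℝ≥0∞)⁻¹).toENNReal +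
      ∫⁻ x : EuclideanSpace ℝ (Fin 1), invOneAdd ‖x‖ ^ 2 := by
  have hm' : (m : ℝ) ≤ 1 := hm
  set a : ℝ → ℝ≥0∞ := (Iic (m : ℝ)).indicator fun _ => (m : ℝ≥0∞)⁻¹ with ha
  set b : ℝ → ℝ≥0∞ := (Ioc (m : ℝ) 1).indicator fun t => (ENNReal.ofReal t)⁻¹ with hb
  have ham : Measurable a := measurable_const.indicator measurableSet_Iic
  have hbm : Measurable b := Measurable.indicator (by fun_prop) measurableSet_Ioc
  have hpt : ∀ x : EuclideanSpace ℝ (Fin 1), shellDensity m x * invOneAdd (shellEnergy m x) ^ 2 ≤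
      a ‖x‖ + b ‖x‖ + invOneAdd ‖x‖ ^ 2 := by
    intro x
    have hd : shellDensity m x * invOneAdd (shellEnergy m x) ^ 2 ≤ shellDensity m x :=
      mul_le_of_le_one_right' (pow_le_one' (invOneAdd_le_one (shellEnergy_nonneg m x)) 2)
    rcases le_or_gt ‖x‖ m with h1 | h1
    · refine le_add_right (le_add_right ?_)
      rw [ha, indicator_of_mem (by exact h1)]
      exact hd.trans (shellDensity_le_inv_mass m x)
    rcases le_or_gt ‖x‖ 1 with h2 | h2
    · refine le_add_right (le_add_left ?_)
      rw [hb, indicator_of_mem (by exact ⟨h1, h2⟩)]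
      exact hd.trans (shellDensity_le_inv_norm m x)
    · refine le_add_left ?_
      have : shellDensity m x ≤ 1 := (shellDensity_le_inv_norm m x).trans
        (ENNReal.inv_le_one.2 (ENNReal.one_le_ofReal.2 h2.le))
      calc _ ≤ 1 * invOneAdd ‖x‖ ^ 2 :=
            mul_le_mul' this (pow_le_pow_left' (invOneAdd_anti (norm_le_shellEnergy m x)) 2)
        _ = _ := one_mul _
  refine (lintegral_mono hpt).trans ?_
  rw [lintegral_add_left (by fun_prop), lintegral_add_left (by fun_prop),
    lintegral_norm_euclideanSpace_one ham, lintegral_norm_euclideanSpace_one hbm]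
  refine add_le_add (add_le_add ?_ ?_) le_rfl
  · have : (fun t : ℝ => a |t|) = (Icc (-(m : ℝ)) m).indicator fun _ => (m : ℝ≥0∞)⁻¹ := by
      ext t
      simp only [ha, indicator, mem_Iic, abs_le, mem_Icc]
    rw [this, lintegral_indicator_const measurableSet_Icc, Real.volume_Icc,
      show (m : ℝ) - -m = 2 * m by ring, ENNReal.ofReal_mul (by norm_num),
      ENNReal.ofReal_coe_nnreal, mul_left_comm]
    -- This covers `m = 0` as well, where the product is `∞ * 0 = 0`.
    calc ENNReal.ofReal 2 * ((m : ℝ≥0∞)⁻¹ * m) ≤ ENNReal.ofReal 2 * 1 :=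
          mul_le_mul' le_rfl (ENNReal.inv_mul_le_one _)
      _ = 2 := by simp
  · have hneg : ∫⁻ t : ℝ, b (-t) = ∫⁻ t, b t :=
      (Measure.measurePreserving_neg (volume : Measure ℝ)).lintegral_comp hbm
    calc ∫⁻ t : ℝ, b |t| ≤ ∫⁻ t : ℝ, b t + b (-t) := by
          refine lintegral_mono fun t => ?_
          rcases abs_choice t with h | h <;> simp [h]
      _ = 2 * ∫⁻ t, b t := by rw [lintegral_add_left hbm, hneg, two_mul]
      _ ≤ _ := by
          rw [hb, lintegral_indicator measurableSet_Ioc]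
          exact mul_le_mul' le_rfl (lintegral_Ioc_inv_le hm)

end DimensionTwo

/-! ### Transfer of finiteness between integrals -/

section Comparison

variable {α : Type*} [MeasurableSpace α] {ρ : Measure α} {s : Set α} {f g : α → ℝ≥0∞} {a : ℝ≥0∞}

theorem setLIntegral_lt_top_of_mul_le (hs : MeasurableSet s) (ha : a ≠ 0)
    (h : ∀ m ∈ s, a * f m ≤ g m) (hg : ∫⁻ m, g m ∂ρ < ∞) : ∫⁻ m in s, f m ∂ρ < ∞ := by
  have h1 : a * ∫⁻ m in s, f m ∂ρ < ∞ :=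
    ((lintegral_const_mul_le _ _).trans ((setLIntegral_mono' hs h).trans
      (setLIntegral_le_lintegral _ _))).trans_lt hg
  exact ENNReal.lt_top_of_mul_ne_top_right h1.ne ha

theorem setLIntegral_lt_top_of_le_mul (hs : MeasurableSet s) (ha : a ≠ ∞)
    (h : ∀ m ∈ s, f m ≤ a * g m) (hg : ∫⁻ m in s, g m ∂ρ < ∞) : ∫⁻ m in s, f m ∂ρ < ∞ := by
  refine (setLIntegral_mono' hs h).trans_lt ?_
  rw [lintegral_const_mul' _ _ ha]
  exact ENNReal.mul_lt_top ha.lt_top hg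

theorem lintegral_lt_top_of_setLIntegral (hs : MeasurableSet s) (h1 : ∫⁻ m in s, f m ∂ρ < ∞)
    (h2 : ∫⁻ m in sᶜ, f m ∂ρ < ∞) : ∫⁻ m, f m ∂ρ < ∞ := by
  rw [← lintegral_add_compl f hs]
  exact ENNReal.add_lt_top.2 ⟨h1, h2⟩

end Comparison

theorem measure_closedBall_ne_zero (n : ℕ) :
    volume (Metric.closedBall (0 : EuclideanSpace ℝ (Fin n)) 1) ≠ 0 :=
  (Metric.measure_closedBall_pos volume _ one_pos).ne'

theorem two_inv_pow_ne_zero (N : ℕ) : (2⁻¹ : ℝ≥0∞) ^ N ≠ 0 :=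
  pow_ne_zero _ (ENNReal.inv_ne_zero.2 (by simp))

theorem lintegral_invOneAdd_lt_top_of_le {ρ : Measure ℝ≥0} {M N : ℕ} (hMN : M ≤ N)
    (h : ∫⁻ m, invOneAdd m ^ M ∂ρ < ∞) : ∫⁻ m, invOneAdd m ^ N ∂ρ < ∞ :=
  (lintegral_mono fun m : ℝ≥0 => invOneAdd_pow_anti m.coe_nonneg hMN).trans_lt h

theorem measure_Iic_one_lt_top {ρ : Measure ℝ≥0} {N : ℕ}
    (h : ∫⁻ m, invOneAdd m ^ N ∂ρ < ∞) : ρ (Iic 1) < ∞ := by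
  rw [← setLIntegral_one]
  refine setLIntegral_lt_top_of_mul_le measurableSet_Iic (two_inv_pow_ne_zero N)
    (fun m hm => ?_) h
  have hm' : (m : ℝ) ≤ 1 := hm
  have h2 : 2⁻¹ ≤ invOneAdd m := by
    simpa [invOneAdd] using invOneAdd_mul_le (r := 0) (s := m) (C := 2) (by norm_num)
      (by linarith)
  simpa using pow_le_pow_left' h2 N

/-! ### Integrability over the mass and the conditions on `ρ` -/

section ShellIntegral

variable {n : ℕ} {ρ : Measure ℝ≥0}

theorem lintegral_shellIntegral_lt_top_of_zero {N : ℕ} (hρ : ∫⁻ m, invOneAdd m ^ N ∂ρ < ∞)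
    (h0 : ∫⁻ m in Iic 1, (m : ℝ≥0∞)⁻¹ ∂ρ < ∞) : ∫⁻ m, shellIntegral 0 N m ∂ρ < ∞ := by
  simp_rw [shellIntegral_zero]
  refine lintegral_lt_top_of_setLIntegral (s := Iic (1 : ℝ≥0)) measurableSet_Iic ?_ ?_
  · refine (setLIntegral_mono' measurableSet_Iic fun m _ => ?_).trans_lt h0
    exact mul_le_of_le_one_right' (pow_le_one' (invOneAdd_le_one m.coe_nonneg) N)
  · refine (setLIntegral_mono' measurableSet_Iic.compl fun m hm => ?_).trans_lt
      ((setLIntegral_le_lintegral _ _).trans_lt hρ)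
    refine mul_le_of_le_one_left' (ENNReal.inv_le_one.2 ?_)
    simpa using le_of_not_ge (show ¬ m ≤ 1 from hm)

theorem lintegral_shellIntegral_lt_top_of_one {N : ℕ} (hN : 2 ≤ N)
    (hρ : ∫⁻ m, invOneAdd m ^ N ∂ρ < ∞)
    (h1 : ∫⁻ m in Iic 1, (ENNReal.log (m : ℝ≥0∞)⁻¹).toENNReal ∂ρ < ∞) :
    ∫⁻ m, shellIntegral 1 (2 * N) m ∂ρ < ∞ := by
  have hC : ∀ M, 2 ≤ M → ∫⁻ x : EuclideanSpace ℝ (Fin 1), invOneAdd ‖x‖ ^ M < ∞ := fun M hM =>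
    (lintegral_mono fun x => invOneAdd_pow_anti (norm_nonneg x) hM).trans_lt
      (lintegral_invOneAdd_norm_lt_top 1)
  refine lintegral_lt_top_of_setLIntegral (s := Iic (1 : ℝ≥0)) measurableSet_Iic ?_ ?_
  · refine (setLIntegral_mono' measurableSet_Iic fun m hm =>
      (shellIntegral_mono 1 (by lia : 2 ≤ 2 * N) m).trans (shellIntegral_one_le hm)).trans_lt ?_
    rw [lintegral_add_right _ measurable_const, lintegral_add_left measurable_const,
      lintegral_const_mul' _ _ (by simp), setLIntegral_const, setLIntegral_const]
    have := measure_Iic_one_lt_top hρ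
    have := hC 2 le_rfl
    finiteness
  · exact setLIntegral_lt_top_of_le_mul measurableSet_Iic.compl (hC N hN).ne
      (fun m hm => shellIntegral_le_of_one_le 1 N (le_of_not_ge hm))
      ((setLIntegral_le_lintegral _ _).trans_lt hρ)

theorem lintegral_shellIntegral_lt_top_of_two_le {N : ℕ} (hn : 2 ≤ n) (hN : n + 1 ≤ N)
    (hρ : ∫⁻ m, invOneAdd m ^ N ∂ρ < ∞) : ∫⁻ m, shellIntegral n (2 * N) m ∂ρ < ∞ := by
  have hC : ∫⁻ x : EuclideanSpace ℝ (Fin n), (ENNReal.ofReal ‖x‖)⁻¹ * invOneAdd ‖x‖ ^ N < ∞ :=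
    (lintegral_mono fun x => mul_le_mul' le_rfl (invOneAdd_pow_anti (norm_nonneg x) hN)).trans_lt
      (lintegral_inv_norm_mul_invOneAdd_lt_top hn)
  refine (lintegral_mono fun m => shellIntegral_le n N m).trans_lt ?_
  rw [lintegral_const_mul' _ _ hC.ne]
  exact ENNReal.mul_lt_top hC hρ

/-- Small masses impose a condition only for `n ≤ 1`; for `n ≥ 2` the bound by `1 / ‖x‖` is uniform
in `m`, so temperedness of `ρ` suffices. -/
theorem exists_lintegral_shellIntegral_lt_top_iff :
    (∃ N, ∫⁻ m, shellIntegral n N m ∂ρ < ∞) ↔ IsTemperedOnHalfLine ρ ∧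
      (n = 0 → ∫⁻ m in Iic 1, (m : ℝ≥0∞)⁻¹ ∂ρ < ∞) ∧
      (n = 1 → ∫⁻ m in Iic 1, (ENNReal.log (m : ℝ≥0∞)⁻¹).toENNReal ∂ρ < ∞) := by
  rw [isTemperedOnHalfLine_iff]
  constructor
  · rintro ⟨N, hN⟩
    refine ⟨⟨N + 1, ?_⟩, ?_, ?_⟩
    · rw [← setLIntegral_univ]
      exact setLIntegral_lt_top_of_mul_le .univ
        (mul_ne_zero (two_inv_pow_ne_zero N) (measure_closedBall_ne_zero n))
        (fun m _ => le_shellIntegral n N m) hN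
    · rintro rfl
      refine setLIntegral_lt_top_of_mul_le measurableSet_Iic (two_inv_pow_ne_zero N)
        (fun m hm => ?_) hN
      have hm' : (m : ℝ) ≤ 1 := hm
      have h2 : 2⁻¹ ≤ invOneAdd m := by
        simpa [invOneAdd] using invOneAdd_mul_le (r := 0) (s := m) (C := 2) (by norm_num)
          (by linarith)
      rw [shellIntegral_zero, mul_comm]
      exact mul_le_mul' le_rfl (pow_le_pow_left' h2 N)
    · rintro rfl
      exact setLIntegral_lt_top_of_mul_le measurableSet_Iic
        (pow_ne_zero N (ENNReal.inv_ne_zero.2 (by simp)))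
        (fun m hm => le_shellIntegral_one N hm) hN
  · rintro ⟨⟨N, hN⟩, h0, h1⟩
    rcases (by lia : n = 0 ∨ n = 1 ∨ 2 ≤ n) with rfl | rfl | hn
    · exact ⟨N, lintegral_shellIntegral_lt_top_of_zero hN (h0 rfl)⟩
    · exact ⟨_, lintegral_shellIntegral_lt_top_of_one (le_max_right N 2)
        (lintegral_invOneAdd_lt_top_of_le (le_max_left N 2) hN) (h1 rfl)⟩
    · exact ⟨_, lintegral_shellIntegral_lt_top_of_two_le hn (le_max_right N (n + 1))
        (lintegral_invOneAdd_lt_top_of_le (le_max_left N (n + 1)) hN)⟩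

/-- Masses are split at `1`: below, the spatial and energy weights are comparable; above,
`spatialIntegral` is comparable to `1 / m` once the exponent exceeds `n`. -/
theorem exists_lintegral_spatialIntegral_lt_top_iff :
    (∃ N, ∫⁻ m, spatialIntegral n N m ∂ρ < ∞) ↔
      (∃ N, ∫⁻ m, shellIntegral n N m ∂ρ < ∞) ∧ ∫⁻ m in Ici 1, (m : ℝ≥0∞)⁻¹ ∂ρ < ∞ := by
  constructor
  · rintro ⟨N, hN⟩
    exact ⟨⟨N, (lintegral_mono fun m => shellIntegral_le_spatialIntegral n N m).trans_lt hN⟩,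
      setLIntegral_lt_top_of_mul_le measurableSet_Ici
        (mul_ne_zero (two_inv_pow_ne_zero (N + 1)) (measure_closedBall_ne_zero n))
        (fun m hm => le_spatialIntegral n N hm) hN⟩
  · rintro ⟨⟨N, hN⟩, h⟩
    set K := max N (n + 1)
    refine ⟨K, lintegral_lt_top_of_setLIntegral (s := Ici (1 : ℝ≥0)) measurableSet_Ici ?_ ?_⟩
    · have hC : ∫⁻ x : EuclideanSpace ℝ (Fin n), invOneAdd ‖x‖ ^ K < ∞ :=
        (lintegral_mono fun x => invOneAdd_pow_anti (norm_nonneg x) (le_max_right N (n + 1))).trans_lt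
          (lintegral_invOneAdd_norm_lt_top n)
      exact setLIntegral_lt_top_of_le_mul measurableSet_Ici hC.ne
        (fun m _ => spatialIntegral_le n K m) h
    · refine setLIntegral_lt_top_of_le_mul (a := 2 ^ N) measurableSet_Ici.compl (by finiteness)
        (fun m hm => ?_) ((setLIntegral_le_lintegral _ _).trans_lt hN)
      exact (spatialIntegral_mono n (le_max_left _ _) m).trans
        (spatialIntegral_le_of_le_one n N (le_of_not_ge hm))

theorem measure_singleton_zero_eq_zero_of_log
    (h : ∫⁻ m in Iic 1, (ENNReal.log (m : ℝ≥0∞)⁻¹).toENNReal ∂ρ < ∞) : ρ {0} = 0 := by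
  by_contra h0
  refine h.not_ge ?_
  calc (∞ : ℝ≥0∞) = ∫⁻ m in {(0 : ℝ≥0)}, (ENNReal.log (m : ℝ≥0∞)⁻¹).toENNReal ∂ρ := by
        rw [lintegral_singleton]
        simp [ENNReal.top_mul h0]
    _ ≤ _ := lintegral_mono_set (by simp)

end ShellIntegral

/-! ### Divergent projections -/

section ZeroInfty

/-- By Chebyshev each level set `‖f‖ ≥ 1 / (k + 1)` of an `L²` function has finite measure, hence
measure `0`; these sets exhaust `f ≠ 0`. -/
theorem isZeroInftyWithTrivialL2_of_forall {X : Type*} [MeasurableSpace X] {κ : Measure X}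
    (h : ∀ E : Set X, MeasurableSet E → κ E = 0 ∨ κ E = ∞) : IsZeroInftyWithTrivialL2 κ := by
  refine ⟨h, fun f => ?_⟩
  rw [Lp.eq_zero_iff_ae_eq_zero]
  have hf : StronglyMeasurable f := Lp.stronglyMeasurable f
  have key : ∀ k : ℕ, κ {x | ((k : ℝ≥0) + 1)⁻¹ ≤ ‖f x‖₊} = 0 := fun k =>
    (h _ (measurableSet_le measurable_const hf.measurable.nnnorm)).resolve_right
      ((Lp.memLp f).meas_ge_lt_top (by simp) (by simp) (by positivity)).ne
  have := measure_iUnion_null key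
  rw [Filter.EventuallyEq, ae_iff]
  refine measure_mono_null (fun x hx => ?_) this
  obtain ⟨k, hk⟩ := exists_nat_one_div_lt (K := ℝ≥0) (nnnorm_pos.2 hx)
  exact mem_iUnion.2 ⟨k, by simpa using hk.le⟩

variable {n : ℕ} {ρ : Measure ℝ≥0}

theorem spatialProjection_massSuperposition_apply [SFinite ρ]
    {E : Set (EuclideanSpace ℝ (Fin n))} (hE : MeasurableSet E) :
    spatialProjection (massSuperposition n ρ) E = ∫⁻ x in E, ∫⁻ m, shellDensity m x ∂ρ := by
  have hE' : MeasurableSet (Prod.snd ⁻¹' E : Set (Momentum n)) := measurable_snd hE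
  rw [spatialProjection, Measure.map_apply measurable_snd hE, ← lintegral_indicator_one hE',
    lintegral_massSuperposition ρ (measurable_one.indicator hE'),
    ← lintegral_lintegral_swap measurable_uncurry_shellDensity.aemeasurable]
  refine lintegral_congr fun m => ?_
  rw [← lintegral_indicator hE]
  refine lintegral_congr fun x => ?_
  by_cases hx : x ∈ E <;> simp [hx]

/-- For `m ≥ 1` one has `m + ‖x‖ ≤ (1 + ‖x‖) m`, so at fixed `x` the density dominates a positive
multiple of `1 / m`. -/
theorem lintegral_shellDensity_eq_top (h : ¬ ∫⁻ m in Ici 1, (m : ℝ≥0∞)⁻¹ ∂ρ < ∞)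
    (x : EuclideanSpace ℝ (Fin n)) : ∫⁻ m, shellDensity m x ∂ρ = ∞ := by
  by_contra h'
  refine h (setLIntegral_lt_top_of_mul_le (a := (ENNReal.ofReal (1 + ‖x‖))⁻¹) measurableSet_Ici
    (ENNReal.inv_ne_zero.2 ENNReal.ofReal_ne_top) (fun m hm => ?_) (Ne.lt_top h'))
  have hm' : (1 : ℝ) ≤ m := hm
  refine le_trans (le_of_eq ?_) ((ENNReal.inv_le_inv.2 (ENNReal.ofReal_le_ofReal
    (show (m : ℝ) + ‖x‖ ≤ (1 + ‖x‖) * m by nlinarith [norm_nonneg x]))).trans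
      (inv_le_shellDensity m x))
  rw [ENNReal.ofReal_mul (by positivity), ENNReal.ofReal_coe_nnreal,
    ENNReal.mul_inv (Or.inr (by simp)) (Or.inl (by simp))]

theorem spatialProjection_massSuperposition_eq_top [SFinite ρ]
    (h : ¬ ∫⁻ m in Ici 1, (m : ℝ≥0∞)⁻¹ ∂ρ < ∞) {E : Set (EuclideanSpace ℝ (Fin n))}
    (hE : MeasurableSet E) :
    spatialProjection (massSuperposition n ρ) E = ∞ * volume E := by
  simp_rw [spatialProjection_massSuperposition_apply hE, lintegral_shellDensity_eq_top h,
    setLIntegral_const]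

theorem isZeroInfty_spatialProjection_massSuperposition [SFinite ρ]
    (h : ¬ ∫⁻ m in Ici 1, (m : ℝ≥0∞)⁻¹ ∂ρ < ∞) :
    IsZeroInftyWithTrivialL2 (spatialProjection (massSuperposition n ρ)) := by
  refine isZeroInftyWithTrivialL2_of_forall fun E hE => ?_
  rw [spatialProjection_massSuperposition_eq_top h hE]
  rcases eq_or_ne (volume E) 0 with h0 | h0
  · simp [h0]
  · exact Or.inr (ENNReal.top_mul h0)

theorem isZeroInfty_spatialProjection {μ : Measure (Momentum n)} {c : ℝ≥0}
    (hr : IsSpectralRepresentation μ c ρ) (h : ¬ ∫⁻ m in Ici 1, (m : ℝ≥0∞)⁻¹ ∂ρ < ∞)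
    (hc : c = 0 ∨ n = 0) : IsZeroInftyWithTrivialL2 (spatialProjection μ) := by
  have := hr.1
  rcases hc with rfl | rfl
  · rw [hr.2.2, zero_smul, zero_add]
    exact isZeroInfty_spatialProjection_massSuperposition h
  -- On a one-point momentum space the superposition already gives every nonempty set measure `∞`,
  -- so the atom changes nothing.
  · refine isZeroInftyWithTrivialL2_of_forall fun E hE => ?_
    rcases E.eq_empty_or_nonempty with rfl | ⟨x, hx⟩
    · simp
    · have : volume E = 1 := by
        rw [volume_euclideanSpace_eq_dirac, Measure.dirac_apply' _ hE,
          indicator_of_mem (by rwa [Subsingleton.elim 0 x]), Pi.one_apply]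
      right
      rw [hr.2.2, spatialProjection, Measure.map_add _ _ measurable_snd, Measure.add_apply]
      refine ENNReal.add_eq_top.2 (Or.inr ?_)
      exact (spatialProjection_massSuperposition_eq_top h hE).trans (by simp [this])

end ZeroInfty

/-! ### Criteria for `σ`-finiteness and cancellation of a factor -/

section SigmaFinite

variable {α β : Type*} [MeasurableSpace α] [MeasurableSpace β]

/-- `κ` is recovered from the finite measure `w κ` through the finite density `1 / w`. -/
theorem sigmaFinite_of_pos_lintegral_lt_top {κ : Measure α} {w : α → ℝ≥0} (hw : Measurable w)
    (hpos : ∀ x, 0 < w x) (hfin : ∫⁻ x, w x ∂κ < ∞) : SigmaFinite κ := by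
  have : IsFiniteMeasure (κ.withDensity fun x => (w x : ℝ≥0∞)) :=
    isFiniteMeasure_withDensity hfin.ne
  rw [← withDensity_inv_same (μ := κ) (f := fun x => (w x : ℝ≥0∞)) (by fun_prop)
    (.of_forall fun x => by simpa using (hpos x).ne') (.of_forall fun x => by simp)]
  exact SigmaFinite.withDensity_of_ne_top' fun x => by simpa using (hpos x).ne'

/-- An image of a `σ`-finite measure need not be `σ`-finite; here a positive integrable weight `w`
is carried along as `w ∘ g`. -/
theorem sigmaFinite_map_of_leftInverse {κ : Measure α} [SigmaFinite κ] {f : α → β} {g : β → α}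
    (hf : Measurable f) (hg : Measurable g) (h : ∀ᵐ x ∂κ, g (f x) = x) :
    SigmaFinite (κ.map f) := by
  obtain ⟨w, hpos, hw, hfin⟩ := exists_pos_lintegral_lt_of_sigmaFinite κ one_ne_zero
  refine sigmaFinite_of_pos_lintegral_lt_top (hw.comp hg) (fun x => hpos (g x)) ?_
  rw [lintegral_map (hw.comp hg).coe_nnreal_ennreal hf]
  refine lt_of_eq_of_lt (lintegral_congr_ae ?_) (hfin.trans ENNReal.one_lt_top)
  filter_upwards [h] with x hx
  simp [hx]

theorem prod_right_cancel {σ τ : Measure α} {κ : Measure β} [SFinite κ] {B : Set β}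
    (hB0 : κ B ≠ 0) (hBtop : κ B ≠ ∞) (h : σ.prod κ = τ.prod κ) : σ = τ := by
  refine Measure.ext fun A _ => ?_
  have := congr($h (A ×ˢ B))
  rw [Measure.prod_prod, Measure.prod_prod] at this
  exact (ENNReal.mul_left_inj hB0 hBtop).1 this

end SigmaFinite

/-- Reciprocal form of `1 + ‖x - y‖ ≤ (1 + ‖x‖) (1 + ‖y‖)`; it lets the weight absorb translations.
-/
theorem mul_invOneAdd_norm_le {V : Type*} [NormedAddCommGroup V] (x y : V) :
    invOneAdd ‖x‖ * invOneAdd ‖y‖ ≤ invOneAdd ‖x - y‖ := by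
  have h := invOneAdd_mul_le (r := ‖y‖) (s := ‖x - y‖) (C := 1 + ‖x‖) (by positivity)
    (by nlinarith [norm_sub_le x y, norm_nonneg x, norm_nonneg y])
  exact h

theorem invOneAdd_ne_zero (r : ℝ) : invOneAdd r ≠ 0 :=
  ENNReal.inv_ne_zero.2 ENNReal.ofReal_ne_top

theorem invOneAdd_pow_ne_zero (N : ℕ) (r : ℝ) : invOneAdd r ^ N ≠ 0 :=
  pow_ne_zero N (invOneAdd_ne_zero _)

/-! ### Translation invariance in one factor forces a product with Lebesgue measure -/

section TranslationInvariant

variable {M V : Type*} [MeasurableSpace M] [NormedAddCommGroup V] [NormedSpace ℝ V]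
  [FiniteDimensional ℝ V] [MeasurableSpace V] [BorelSpace V]

/-- A translation invariant measure that integrates a power of `1 / (1 + ‖x‖)` is a multiple of
Lebesgue measure. -/
theorem exists_eq_smul_of_translation_invariant {κ l : Measure V} [l.IsAddHaarMeasure] {N : ℕ}
    (hκ : ∀ v, κ.map (v + ·) = κ) (hfin : ∫⁻ x, invOneAdd ‖x‖ ^ N ∂κ < ∞) :
    ∃ c : ℝ≥0, κ = c • l := by
  have : κ.IsAddLeftInvariant := ⟨hκ⟩
  have : IsFiniteMeasureOnCompacts κ := by
    refine ⟨fun K hK => ?_⟩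
    obtain ⟨R, hR⟩ := hK.isBounded.subset_closedBall 0
    refine (measure_mono hR).trans_lt ?_
    rw [← setLIntegral_one]
    refine setLIntegral_lt_top_of_mul_le Metric.isClosed_closedBall.measurableSet
      (pow_ne_zero N (invOneAdd_ne_zero R)) (fun x hx => ?_) hfin
    rw [mul_one]
    exact pow_le_pow_left' (invOneAdd_anti (by simpa using hx)) N
  exact ⟨_, Measure.isAddLeftInvariant_eq_smul κ l⟩

/-- For a `σ`-finite translation invariant measure on `M × V` there is a positive weight on `M`
making `1 / (1 + ‖x‖)^N` integrable. -/
theorem exists_weight_of_translation_invariant {ν : Measure (M × V)} [SigmaFinite ν]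
    (l : Measure V) [l.IsAddHaarMeasure]
    (hν : ∀ v : V, ν.map (fun z => (z.1, v + z.2)) = ν) :
    ∃ H : M → ℝ≥0∞, Measurable H ∧ (∀ m, H m ≠ 0) ∧ (∀ m, H m ≠ ∞) ∧
      ∫⁻ z, H z.1 * invOneAdd ‖z.2‖ ^ (Module.finrank ℝ V + 1) ∂ν < ∞ := by
  set N := Module.finrank ℝ V + 1
  have hg : Measurable fun x : V => invOneAdd ‖x‖ ^ N := measurable_invOneAdd_norm_pow N
  obtain ⟨w, hpos, hw, hfin⟩ := exists_pos_lintegral_lt_of_sigmaFinite ν one_ne_zero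
  -- Smearing a positive `ν`-integrable `w` along the fibres leaves a positive function of `m`
  -- alone. It may be infinite, hence the truncation at `1`.
  set h : M → ℝ≥0∞ := fun m => ∫⁻ u, w (m, u) * invOneAdd ‖u‖ ^ N ∂l with hh
  have hint : Measurable fun z : M × V => (w z : ℝ≥0∞) * invOneAdd ‖z.2‖ ^ N :=
    hw.coe_nnreal_ennreal.mul (hg.comp measurable_snd)
  have hint' : ∀ m, Measurable fun u : V => (w (m, u) : ℝ≥0∞) * invOneAdd ‖u‖ ^ N := fun m =>
    hint.comp measurable_prodMk_left
  have hm : Measurable h := hint.lintegral_prod_right'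
  refine ⟨fun m => min (h m) 1, hm.min measurable_const, fun m => ?_, fun m => by simp, ?_⟩
  · have : h m ≠ 0 := by
      simp only [hh, Ne, lintegral_eq_zero_iff (hint' m)]
      intro h0
      have : ∀ᵐ u ∂l, False := by
        filter_upwards [h0] with u hu
        simp only [Pi.zero_apply, mul_eq_zero] at hu
        exact hu.elim (by simpa using (hpos (m, u)).ne') (invOneAdd_pow_ne_zero N ‖u‖)
      have h00 : l univ = 0 := by simpa [ae_iff] using this
      exact NeZero.ne l (Measure.measure_univ_eq_zero.1 h00)
    simp [this]
  · have hshift : Measurable fun z : (M × V) × V => (w (z.1.1, z.2 + z.1.2) : ℝ≥0∞) *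
        invOneAdd ‖z.2‖ ^ N :=
      (hw.comp ((measurable_fst.comp measurable_fst).prodMk
        (measurable_snd.add (measurable_snd.comp measurable_fst)))).coe_nnreal_ennreal.mul
        (hg.comp measurable_snd)
    calc ∫⁻ z, min (h z.1) 1 * invOneAdd ‖z.2‖ ^ N ∂ν
        ≤ ∫⁻ z, (∫⁻ v, w (z.1, v + z.2) * invOneAdd ‖v‖ ^ N ∂l) ∂ν := by
          -- After substituting `u = v + z.2` the shift sits in the weight, and
          -- `mul_invOneAdd_norm_le` bounds the shifted weight below by a product. Tonelli and
          -- invariance of `ν` then remove the shift from `w`.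
          refine lintegral_mono fun z => ?_
          have htr := lintegral_add_right_eq_self (μ := l)
            (fun u => (w (z.1, u) : ℝ≥0∞) * invOneAdd ‖u - z.2‖ ^ N) z.2
          simp only [add_sub_cancel_right] at htr
          rw [htr]
          refine (mul_le_mul' (min_le_left _ _) le_rfl).trans ?_
          simp only [hh, ← lintegral_mul_const _ (hint' z.1)]
          refine lintegral_mono fun u => ?_
          rw [mul_assoc, ← mul_pow]
          exact mul_le_mul' le_rfl (pow_le_pow_left' (mul_invOneAdd_norm_le u z.2) N)
      _ = ∫⁻ v, (∫⁻ z, w (z.1, v + z.2) * invOneAdd ‖v‖ ^ N ∂ν) ∂l :=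
          lintegral_lintegral_swap hshift.aemeasurable
      _ = ∫⁻ v, (∫⁻ z, w z ∂ν) * invOneAdd ‖v‖ ^ N ∂l := by
          refine lintegral_congr fun v => ?_
          have hv : Measurable fun z : M × V => (z.1, v + z.2) := by fun_prop
          have hwv : Measurable fun z : M × V => (w (z.1, v + z.2) : ℝ≥0∞) :=
            (hw.comp hv).coe_nnreal_ennreal
          rw [lintegral_mul_const _ hwv]
          congr 1
          conv_rhs => rw [← hν v, lintegral_map hw.coe_nnreal_ennreal hv]
      _ = (∫⁻ z, w z ∂ν) * ∫⁻ v, invOneAdd ‖v‖ ^ N ∂l := lintegral_const_mul _ hg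
      _ < ∞ := ENNReal.mul_lt_top (hfin.trans ENNReal.one_lt_top)
          (lintegral_invOneAdd_norm_finrank_lt_top l)

/-- A `σ`-finite measure on `M × V` that is invariant under translations of the second factor is
a product with Lebesgue measure. -/
theorem exists_eq_prod_of_translation_invariant {ν : Measure (M × V)} [SigmaFinite ν]
    (l : Measure V) [l.IsAddHaarMeasure]
    (hν : ∀ v : V, ν.map (fun z => (z.1, v + z.2)) = ν) :
    ∃ σ : Measure M, SigmaFinite σ ∧ ν = σ.prod l := by
  obtain ⟨H, hHm, hH0, hHtop, hfin⟩ := exists_weight_of_translation_invariant l hν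
  set N := Module.finrank ℝ V + 1
  have hg : Measurable fun x : V => invOneAdd ‖x‖ ^ N := measurable_invOneAdd_norm_pow N
  have hg2 : Measurable fun z : M × V => invOneAdd ‖z.2‖ ^ N := hg.comp measurable_snd
  have hH1 : Measurable fun z : M × V => H z.1 := hHm.comp measurable_fst
  set C := ∫⁻ v, invOneAdd ‖v‖ ^ N ∂l with hC
  have hCtop : C ≠ ∞ := (lintegral_invOneAdd_norm_finrank_lt_top l).ne
  have hC0 : C ≠ 0 := by
    rw [hC, Ne, lintegral_eq_zero_iff hg]
    intro h0
    have : ∀ᵐ u ∂l, False := h0.mono fun u hu => invOneAdd_pow_ne_zero N ‖u‖ hu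
    have h00 : l univ = 0 := by simpa [ae_iff] using this
    exact NeZero.ne l (Measure.measure_univ_eq_zero.1 h00)
  set ν' := ν.withDensity fun z => H z.1 with hν'
  have hfin' : ∫⁻ z, invOneAdd ‖z.2‖ ^ N ∂ν' < ∞ := by
    rwa [hν', lintegral_withDensity_eq_lintegral_mul _ hH1 hg2]
  -- If `ν'` is `τ ⊗ l`, integrating the weight over the fibres yields `C τ`; this dictates `τ`.
  set τ : Measure M := C⁻¹ • (ν'.withDensity fun z => invOneAdd ‖z.2‖ ^ N).map Prod.fst with hτ
  have : IsFiniteMeasure (ν'.withDensity fun z => invOneAdd ‖z.2‖ ^ N) :=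
    isFiniteMeasure_withDensity hfin'.ne
  have : IsFiniteMeasure τ := Measure.smul_finite _ (ENNReal.inv_ne_top.2 hC0)
  have hprod : τ.prod l = ν' := by
    refine Measure.prod_eq fun A B hA hB => ?_
    -- The slice over `A` is translation invariant with an integrable weight, so it is `c • l`;
    -- normalization by `C` gives `τ A = c`.
    set κ := (ν'.restrict (Prod.fst ⁻¹' A)).map Prod.snd with hκ
    have hAm : MeasurableSet (Prod.fst ⁻¹' A : Set (M × V)) := measurable_fst hA
    have hκapp : ∀ f : V → ℝ≥0∞, Measurable f →
        ∫⁻ x, f x ∂κ = ∫⁻ z, A.indicator H z.1 * f z.2 ∂ν := by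
      intro f hf
      have hfA : Measurable ((Prod.fst ⁻¹' A).indicator fun z : M × V => f z.2) :=
        (hf.comp measurable_snd).indicator hAm
      rw [hκ, lintegral_map hf measurable_snd, ← lintegral_indicator hAm, hν',
        lintegral_withDensity_eq_lintegral_mul _ hH1 hfA]
      refine lintegral_congr fun z => ?_
      by_cases hz : z.1 ∈ A <;> simp [hz]
    have hinv : ∀ v, κ.map (v + ·) = κ := by
      intro v
      have hv : Measurable fun z : M × V => (z.1, v + z.2) := by fun_prop
      refine Measure.ext_of_lintegral _ fun f hf => ?_
      rw [lintegral_map hf (by fun_prop), hκapp _ (by fun_prop), hκapp _ hf]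
      have hF : Measurable fun z : M × V => A.indicator H z.1 * f z.2 :=
        ((hHm.indicator hA).comp measurable_fst).mul (hf.comp measurable_snd)
      conv_rhs => rw [← hν v, lintegral_map hF hv]
    have hτA : τ A = C⁻¹ * ∫⁻ x, invOneAdd ‖x‖ ^ N ∂κ := by
      rw [hτ, Measure.smul_apply, Measure.map_apply measurable_fst hA, withDensity_apply _ hAm,
        hκ, lintegral_map hg measurable_snd, smul_eq_mul]
    obtain ⟨c, hc⟩ := exists_eq_smul_of_translation_invariant (l := l) (N := N) hinv (by
      rw [hκ, lintegral_map hg measurable_snd]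
      exact (setLIntegral_le_lintegral _ _).trans_lt hfin')
    have hB' : ν' (A ×ˢ B) = κ B := by
      rw [hκ, Measure.map_apply measurable_snd hB, Measure.restrict_apply (measurable_snd hB),
        inter_comm]
      rfl
    rw [hB', hτA, hc, lintegral_smul_measure, ← hC, Measure.smul_apply]
    simp only [ENNReal.smul_def, smul_eq_mul]
    rw [mul_left_comm, ENNReal.inv_mul_cancel hC0 hCtop, mul_one]
  refine ⟨τ.withDensity fun m => (H m)⁻¹,
    SigmaFinite.withDensity_of_ne_top' fun m => ENNReal.inv_ne_top.2 (hH0 m), ?_⟩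
  rw [prod_withDensity_left (by fun_prop), hprod, hν', withDensity_inv_same hH1
    (.of_forall fun z => hH0 z.1) (.of_forall fun z => hHtop z.1)]

/-- The same for translations whose size depends on the first factor. -/
theorem exists_eq_prod_of_scaled_translation_invariant {ν : Measure (M × V)} [SigmaFinite ν]
    (l : Measure V) [l.IsAddHaarMeasure] {a : M → ℝ} (ha : Measurable a) (ha0 : ∀ m, a m ≠ 0)
    (hν : ∀ v : V, ν.map (fun z => (z.1, a z.1 • v + z.2)) = ν) :
    ∃ σ : Measure M, SigmaFinite σ ∧ ν = σ.prod l := by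
  -- Dividing the second coordinate by `a` turns the scaled translations into genuine ones; undoing
  -- it costs only a Jacobian depending on `m`, which goes into `σ`.
  set D : M × V → M × V := fun z => (z.1, (a z.1)⁻¹ • z.2) with hD
  set E : M × V → M × V := fun z => (z.1, a z.1 • z.2) with hE
  have hDm : Measurable D := by fun_prop
  have hEm : Measurable E := by fun_prop
  have hED : ∀ z, E (D z) = z := fun z => by simp [hE, hD, smul_smul, ha0]
  have : SigmaFinite (ν.map D) := sigmaFinite_map_of_leftInverse hDm hEm (.of_forall hED)
  obtain ⟨σ, hσ, h⟩ := exists_eq_prod_of_translation_invariant (ν := ν.map D) l fun v => by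
    rw [Measure.map_map (by fun_prop) hDm]
    conv_rhs => rw [← hν v, Measure.map_map hDm (by fun_prop)]
    congr 1
    ext z : 1
    simp [hD, smul_add, smul_smul, ha0]
  set b : M → ℝ≥0∞ := fun m => ENNReal.ofReal |(a m ^ Module.finrank ℝ V)⁻¹| with hb
  have hbm : Measurable b := by fun_prop
  refine ⟨σ.withDensity b, SigmaFinite.withDensity_of_ne_top' fun m => ENNReal.ofReal_ne_top, ?_⟩
  have hνE : ν = (σ.prod l).map E := by
    rw [← h, Measure.map_map hEm hDm, show E ∘ D = id from funext hED, Measure.map_id]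
  refine Measure.ext_of_lintegral _ fun f hf => ?_
  have hfE : Measurable fun z => f (E z) := hf.comp hEm
  rw [hνE, lintegral_map hf hEm, lintegral_prod _ hfE.aemeasurable,
    lintegral_prod _ hf.aemeasurable, lintegral_withDensity_eq_lintegral_mul _ hbm
      hf.lintegral_prod_right']
  refine lintegral_congr fun m => ?_
  have hm : Measurable fun y : V => f (m, y) := hf.comp measurable_prodMk_left
  have := congr(lintegral $(Measure.map_addHaar_smul l (ha0 m)) fun y => f (m, y))
  rw [lintegral_map hm (by fun_prop), lintegral_smul_measure] at this
  exact this

end TranslationInvariant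

/-! ### Light-cone coordinates, boosts, null rotations and the reflection -/

section LightConeCoordinates

/-- The splitting `ℝ^(k+1) = ℝ × ℝ^k` into a longitudinal and a transversal part. -/
def spatialSplit (k : ℕ) :
    WithLp 2 (ℝ × EuclideanSpace ℝ (Fin k)) ≃ₗᵢ[ℝ] EuclideanSpace ℝ (Fin (k + 1)) :=
  ((stdOrthonormalBasis ℝ (WithLp 2 (ℝ × EuclideanSpace ℝ (Fin k)))).reindex
    (finCongr (by
      rw [(WithLp.linearEquiv 2 ℝ (ℝ × EuclideanSpace ℝ (Fin k))).finrank_eq,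
        Module.finrank_prod]
      simp [add_comm]))).repr

/-- Light-cone coordinates `(u, v, y) = (p₀ + p₁, p₀ - p₁, y)`. -/
abbrev LightConeSpace (k : ℕ) : Type := ℝ × ℝ × EuclideanSpace ℝ (Fin k)

/-- The passage to light-cone coordinates. -/
def lightConeCoord (k : ℕ) : Momentum (k + 1) ≃ₗ[ℝ] LightConeSpace k where
  toFun p := (p.1 + ((spatialSplit k).symm p.2).fst, p.1 - ((spatialSplit k).symm p.2).fst,
    ((spatialSplit k).symm p.2).snd)
  invFun q := ((q.1 + q.2.1) / 2, spatialSplit k (WithLp.toLp 2 ((q.1 - q.2.1) / 2, q.2.2)))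
  map_add' p q := by
    ext <;> simp <;> ring
  map_smul' c p := by
    ext <;> simp <;> ring
  left_inv p := by
    refine Prod.ext ?_ ?_
    · simp
    · rw [← (spatialSplit k).eq_symm_apply]
      refine (WithLp.ofLp_injective 2) (Prod.ext ?_ rfl)
      simp
  right_inv q := by
    refine Prod.ext ?_ (Prod.ext ?_ ?_)
    · simp; ring
    · simp; ring
    · simp

variable {k : ℕ}

theorem lightConeCoord_split (e a : ℝ) (y : EuclideanSpace ℝ (Fin k)) :
    lightConeCoord k (e, spatialSplit k (WithLp.toLp 2 (a, y))) = (e + a, e - a, y) := by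
  simp [lightConeCoord]

/-- The Lorentzian form in light-cone coordinates. -/
def lightConeForm (q r : LightConeSpace k) : ℝ :=
  (q.1 * r.2.1 + q.2.1 * r.1) / 2 - inner ℝ q.2.2 r.2.2

theorem lorentzForm_eq_lightConeForm (p q : Momentum (k + 1)) :
    lorentzForm p q = lightConeForm (lightConeCoord k p) (lightConeCoord k q) := by
  have h : inner ℝ p.2 q.2 =
      inner ℝ ((spatialSplit k).symm p.2) ((spatialSplit k).symm q.2) :=
    ((spatialSplit k).symm.inner_map_map _ _).symm
  rw [lorentzForm, lightConeForm, h, WithLp.prod_inner_apply]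
  simp [lightConeCoord]
  ring

theorem measurable_lightConeCoord (k : ℕ) : Measurable (lightConeCoord k) :=
  (lightConeCoord k).toLinearMap.continuous_of_finiteDimensional.measurable

theorem measurable_lightConeCoord_symm (k : ℕ) : Measurable (lightConeCoord k).symm :=
  (lightConeCoord k).symm.toLinearMap.continuous_of_finiteDimensional.measurable

theorem measurable_lightConeSpace_linearEquiv (T : LightConeSpace k ≃ₗ[ℝ] LightConeSpace k) :
    Measurable T :=
  T.toLinearMap.continuous_of_finiteDimensional.measurable

/-- A Lorentz invariant measure is invariant, in light-cone coordinates, under all linear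
automorphisms preserving the form and the time direction. -/
theorem IsLorentzInvariantOnCone.map_lightCone {μ : Measure (Momentum (k + 1))}
    (hμ : IsLorentzInvariantOnCone μ) {T : LightConeSpace k ≃ₗ[ℝ] LightConeSpace k}
    (hT : ∀ q r, lightConeForm (T q) (T r) = lightConeForm q r)
    (hpos : 0 < (T (1, 1, 0)).1 + (T (1, 1, 0)).2.1) :
    (μ.map (lightConeCoord k)).map T = μ.map (lightConeCoord k) := by
  set g := ((lightConeCoord k).trans T).trans (lightConeCoord k).symm with hg
  have hgT : ∀ p, lightConeCoord k (g p) = T (lightConeCoord k p) := fun p => by simp [hg]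
  have hmem : g ∈ orthochronousLorentz (k + 1) := by
    refine ⟨fun p q => ?_, ?_⟩
    · rw [lorentzForm_eq_lightConeForm, hgT, hgT, hT, ← lorentzForm_eq_lightConeForm]
    · have h1 : lightConeCoord k (1, 0) = (1, 1, 0) := by simp [lightConeCoord]
      change 0 < ((lightConeCoord k).symm (T (lightConeCoord k (1, 0)))).1
      rw [h1]
      exact half_pos hpos
  have hgm : Measurable g := g.toLinearMap.continuous_of_finiteDimensional.measurable
  conv_rhs => rw [← hμ.2 g hmem]
  rw [Measure.map_map (measurable_lightConeSpace_linearEquiv T) (measurable_lightConeCoord k),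
    Measure.map_map (measurable_lightConeCoord k) hgm]
  congr 1
  exact funext fun p => (hgT p).symm

/-- Lorentz boosts in the longitudinal direction. -/
def boost (k : ℕ) (t : ℝ) : LightConeSpace k ≃ₗ[ℝ] LightConeSpace k where
  toFun q := (Real.exp t * q.1, Real.exp (-t) * q.2.1, q.2.2)
  invFun q := (Real.exp (-t) * q.1, Real.exp t * q.2.1, q.2.2)
  map_add' p q := by simp [mul_add]
  map_smul' c p := by simp [mul_left_comm]
  left_inv q := by simp [← mul_assoc, ← Real.exp_add]
  right_inv q := by simp [← mul_assoc, ← Real.exp_add]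

/-- Null rotations, which fix the coordinate `u` and translate `y` by `u w`. -/
def nullRotation (w : EuclideanSpace ℝ (Fin k)) : LightConeSpace k ≃ₗ[ℝ] LightConeSpace k where
  toFun q := (q.1, q.2.1 + 2 * inner ℝ w q.2.2 + ‖w‖ ^ 2 * q.1, q.1 • w + q.2.2)
  invFun q := (q.1, q.2.1 - 2 * inner ℝ w q.2.2 + ‖w‖ ^ 2 * q.1, -(q.1 • w) + q.2.2)
  map_add' p q := by
    refine Prod.ext rfl (Prod.ext ?_ ?_)
    · simp [inner_add_right]; ring
    · simp only [Prod.fst_add, Prod.snd_add, add_smul]; abel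
  map_smul' c p := by
    refine Prod.ext rfl (Prod.ext ?_ ?_)
    · simp [inner_smul_right]; ring
    · simp [smul_smul]
  left_inv q := by
    refine Prod.ext rfl (Prod.ext ?_ ?_)
    · simp [inner_add_right, inner_smul_right]; ring
    · simp
  right_inv q := by
    refine Prod.ext rfl (Prod.ext ?_ ?_)
    · simp [inner_add_right, inner_smul_right]; ring
    · simp

/-- The reflection of the longitudinal direction. -/
def lightConeSwap (k : ℕ) : LightConeSpace k ≃ₗ[ℝ] LightConeSpace k where
  toFun q := (q.2.1, q.1, q.2.2)
  invFun q := (q.2.1, q.1, q.2.2)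
  map_add' _ _ := rfl
  map_smul' _ _ := rfl
  left_inv _ := rfl
  right_inv _ := rfl

theorem lightConeForm_boost (t : ℝ) (q r : LightConeSpace k) :
    lightConeForm (boost k t q) (boost k t r) = lightConeForm q r := by
  have h : Real.exp t * Real.exp (-t) = 1 := by simp [← Real.exp_add]
  simp only [lightConeForm, boost, LinearEquiv.coe_mk, LinearMap.coe_mk, AddHom.coe_mk]
  linear_combination (q.1 * r.2.1 + q.2.1 * r.1) / 2 * h

theorem lightConeForm_nullRotation (w : EuclideanSpace ℝ (Fin k)) (q r : LightConeSpace k) :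
    lightConeForm (nullRotation w q) (nullRotation w r) = lightConeForm q r := by
  simp only [lightConeForm, nullRotation, LinearEquiv.coe_mk, LinearMap.coe_mk, AddHom.coe_mk,
    inner_add_left, inner_add_right, real_inner_smul_left, real_inner_smul_right,
    real_inner_self_eq_norm_sq]
  rw [real_inner_comm w q.2.2]
  ring

theorem lightConeForm_swap (q r : LightConeSpace k) :
    lightConeForm (lightConeSwap k q) (lightConeSwap k r) = lightConeForm q r := by
  simp only [lightConeForm, lightConeSwap, LinearEquiv.coe_mk, LinearMap.coe_mk, AddHom.coe_mk]
  ring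

end LightConeCoordinates

/-! ### Mass shells in light-cone coordinates -/

section MassShell

variable {k : ℕ}

/-- The substitution `a = (e^s - M e^(-s)) / 2` on a hyperbola. -/
theorem lintegral_hyperbola {M : ℝ} (hM : 0 ≤ M) (f : ℝ → ℝ → ℝ≥0∞) :
    ∫⁻ a, {a : ℝ | 0 < √(M + a ^ 2) + a}.indicator
      (fun a => (ENNReal.ofReal √(M + a ^ 2))⁻¹ * f (√(M + a ^ 2) + a) (√(M + a ^ 2) - a)) a =
    ∫⁻ s, f (Real.exp s) (M * Real.exp (-s)) := by
  set φ : ℝ → ℝ := fun s => (Real.exp s - M * Real.exp (-s)) / 2 with hφ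
  -- The derivative of `φ` equals the energy `√(M + φ²)`, so the Jacobian cancels the density
  -- exactly.
  set φ' : ℝ → ℝ := fun s => (Real.exp s + M * Real.exp (-s)) / 2 with hφ'
  have hee : ∀ s, Real.exp s * Real.exp (-s) = 1 := fun s => by simp [← Real.exp_add]
  have hpos : ∀ s, 0 < φ' s := fun s => by
    have := Real.exp_pos s
    have := mul_nonneg hM (Real.exp_pos (-s)).le
    simp only [hφ']
    linarith
  have hsq : ∀ s, √(M + φ s ^ 2) = φ' s := fun s => by
    rw [← Real.sqrt_sq (hpos s).le]
    congr 1
    simp only [hφ, hφ']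
    linear_combination -M * hee s
  have hadd : ∀ s, √(M + φ s ^ 2) + φ s = Real.exp s := fun s => by
    rw [hsq]; simp only [hφ, hφ']; ring
  have hsub : ∀ s, √(M + φ s ^ 2) - φ s = M * Real.exp (-s) := fun s => by
    rw [hsq]; simp only [hφ, hφ']; ring
  have hinj : InjOn φ univ := fun s _ t _ h => by
    have := hadd s
    rw [h, hadd t] at this
    exact (Real.exp_injective this).symm
  have hder : ∀ s ∈ univ, HasDerivWithinAt φ (φ' s) univ s := fun s _ => by
    have h1 := (Real.hasDerivAt_exp s).sub (((hasDerivAt_neg s).exp).const_mul M)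
    refine ((h1.div_const 2).congr_deriv ?_).hasDerivWithinAt
    simp only [hφ']
    ring
  have himage : φ '' univ = {a : ℝ | 0 < √(M + a ^ 2) + a} := by
    ext a
    simp only [image_univ, mem_range, mem_ofPred_eq]
    constructor
    · rintro ⟨s, rfl⟩
      rw [hadd]
      exact Real.exp_pos s
    · intro ha
      refine ⟨Real.log (√(M + a ^ 2) + a), ?_⟩
      have h2 : √(M + a ^ 2) ^ 2 = M + a ^ 2 := Real.sq_sqrt (by positivity)
      simp only [hφ, Real.exp_neg, Real.exp_log ha]
      field_simp
      linear_combination h2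
  have hmeas : MeasurableSet {a : ℝ | 0 < √(M + a ^ 2) + a} :=
    measurableSet_lt measurable_const (by fun_prop)
  rw [lintegral_indicator hmeas, ← himage,
    lintegral_image_eq_lintegral_abs_deriv_mul .univ hder hinj, Measure.restrict_univ]
  refine lintegral_congr fun s => ?_
  rw [hadd, hsub, hsq, abs_of_pos (hpos s), ← mul_assoc, ENNReal.mul_inv_cancel, one_mul]
  · simpa using hpos s
  · exact ENNReal.ofReal_ne_top

theorem lintegral_spatialSplit {f : EuclideanSpace ℝ (Fin (k + 1)) → ℝ≥0∞} (hf : Measurable f) :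
    ∫⁻ x, f x = ∫⁻ y : EuclideanSpace ℝ (Fin k), ∫⁻ a : ℝ,
      f (spatialSplit k (WithLp.toLp 2 (a, y))) := by
  have hmp := (spatialSplit k).measurePreserving.comp
    (WithLp.volume_preserving_toLp ℝ (EuclideanSpace ℝ (Fin k)))
  rw [← hmp.lintegral_comp hf, Measure.volume_eq_prod]
  exact lintegral_prod_symm _ (hf.comp hmp.measurable).aemeasurable

theorem shellEnergy_spatialSplit (m : ℝ≥0) (a : ℝ) (y : EuclideanSpace ℝ (Fin k)) :
    shellEnergy m (spatialSplit k (WithLp.toLp 2 (a, y))) =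
      √((m : ℝ) ^ 2 + ‖y‖ ^ 2 + a ^ 2) := by
  rw [shellEnergy, LinearIsometryEquiv.norm_map, WithLp.prod_norm_sq_eq_of_L2]
  simp [add_assoc, add_comm (a ^ 2)]

theorem measurable_shellEnergy_mk {n : ℕ} (m : ℝ≥0) :
    Measurable fun x : EuclideanSpace ℝ (Fin n) => ((shellEnergy m x, x) : Momentum n) :=
  (measurable_shellEnergy m).prodMk measurable_id

theorem lintegral_map_massSuperposition (ρ : Measure ℝ≥0) {f : LightConeSpace k → ℝ≥0∞}
    (hf : Measurable f) :
    ∫⁻ q, f q ∂(massSuperposition (k + 1) ρ).map (lightConeCoord k) =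
      ∫⁻ m, (∫⁻ y : EuclideanSpace ℝ (Fin k), ∫⁻ a : ℝ,
        (ENNReal.ofReal √((m : ℝ) ^ 2 + ‖y‖ ^ 2 + a ^ 2))⁻¹ *
          f (√((m : ℝ) ^ 2 + ‖y‖ ^ 2 + a ^ 2) + a, √((m : ℝ) ^ 2 + ‖y‖ ^ 2 + a ^ 2) - a, y)) ∂ρ := by
  have hfc : Measurable fun p => f (lightConeCoord k p) := hf.comp (measurable_lightConeCoord k)
  rw [lintegral_map hf (measurable_lightConeCoord k), lintegral_massSuperposition ρ hfc]
  refine lintegral_congr fun m => ?_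
  have hm : Measurable fun x => shellDensity m x * f (lightConeCoord k (shellEnergy m x, x)) :=
    (measurable_shellDensity m).mul (hfc.comp (measurable_shellEnergy_mk m))
  rw [lintegral_spatialSplit hm]
  simp only [shellDensity, shellEnergy_spatialSplit, lightConeCoord_split]

end MassShell

/-! ### Measures on `{u > 0}` in mass, rapidity and transversal momentum -/

section Chart

variable {k : ℕ}

/-- The parametrization of `{u > 0}` in the cone by mass, rapidity and transversal momentum. -/
def lightConeChart (k : ℕ) (z : (ℝ≥0 × ℝ) × EuclideanSpace ℝ (Fin k)) : LightConeSpace k :=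
  (Real.exp z.1.2, ((z.1.1 : ℝ) ^ 2 + ‖z.2‖ ^ 2) * Real.exp (-z.1.2), z.2)

/-- The inverse of `lightConeChart`. -/
def lightConeChartInv (k : ℕ) (q : LightConeSpace k) : (ℝ≥0 × ℝ) × EuclideanSpace ℝ (Fin k) :=
  (((√(q.1 * q.2.1 - ‖q.2.2‖ ^ 2)).toNNReal, Real.log q.1), q.2.2)

theorem measurable_lightConeChart (k : ℕ) : Measurable (lightConeChart k) := by
  unfold lightConeChart; fun_prop

theorem measurable_lightConeChartInv (k : ℕ) : Measurable (lightConeChartInv k) := by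
  unfold lightConeChartInv; fun_prop

theorem measurableSet_fst_pos (k : ℕ) : MeasurableSet {q : LightConeSpace k | 0 < q.1} :=
  measurableSet_lt measurable_const measurable_fst

theorem lightConeChart_chartInv {q : LightConeSpace k} (hq : 0 < q.1)
    (h : ‖q.2.2‖ ^ 2 ≤ q.1 * q.2.1) : lightConeChart k (lightConeChartInv k q) = q := by
  refine Prod.ext ?_ (Prod.ext ?_ rfl)
  · simp [lightConeChart, lightConeChartInv, Real.exp_log hq]
  · simp only [lightConeChart, lightConeChartInv, Real.coe_toNNReal _ (Real.sqrt_nonneg _),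
      Real.sq_sqrt (sub_nonneg.2 h), Real.exp_neg, Real.exp_log hq]
    field_simp
    ring

/-- A map preserving `u > 0` and a measure preserves its restriction to `{u > 0}`. -/
theorem map_restrict_fst_pos {κ : Measure (LightConeSpace k)}
    {T : LightConeSpace k ≃ₗ[ℝ] LightConeSpace k} (hT : κ.map T = κ)
    (hpos : ∀ q, 0 < (T q).1 ↔ 0 < q.1) :
    (κ.restrict {q | 0 < q.1}).map T = κ.restrict {q | 0 < q.1} := by
  conv_rhs => rw [← hT, Measure.restrict_map (measurable_lightConeSpace_linearEquiv T)
    (measurableSet_fst_pos k)]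
  congr 2
  ext q
  exact (hpos q).symm

/-- `S` is the expression of `T` in the chart; it has to match only where `u > 0`, since the
restricted measure ignores the rest. -/
theorem map_chartInv_eq {κ : Measure (LightConeSpace k)}
    {T : LightConeSpace k ≃ₗ[ℝ] LightConeSpace k}
    {S : (ℝ≥0 × ℝ) × EuclideanSpace ℝ (Fin k) → (ℝ≥0 × ℝ) × EuclideanSpace ℝ (Fin k)}
    (hS : Measurable S) (hT : κ.map T = κ) (hpos : ∀ q, 0 < (T q).1 ↔ 0 < q.1)
    (hST : ∀ q, 0 < q.1 → S (lightConeChartInv k q) = lightConeChartInv k (T q)) :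
    ((κ.restrict {q | 0 < q.1}).map (lightConeChartInv k)).map S =
      (κ.restrict {q | 0 < q.1}).map (lightConeChartInv k) := by
  have hI := measurable_lightConeChartInv k
  conv_rhs => rw [← map_restrict_fst_pos hT hpos,
    Measure.map_map hI (measurable_lightConeSpace_linearEquiv T)]
  rw [Measure.map_map hS hI]
  refine Measure.map_congr ?_
  filter_upwards [ae_restrict_mem (measurableSet_fst_pos k)] with q hq
  exact hST q hq

/-- The part in `{u > 0}` of a measure on the cone that is invariant under boosts and null
rotations is Lebesgue measure in rapidity and transversal momentum. -/
theorem exists_restrict_fst_pos_eq {κ : Measure (LightConeSpace k)} [SigmaFinite κ]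
    (hcone : ∀ᵐ q ∂κ, ‖q.2.2‖ ^ 2 ≤ q.1 * q.2.1) (hboost : ∀ t, κ.map (boost k t) = κ)
    (hnull : ∀ w : EuclideanSpace ℝ (Fin k), κ.map (nullRotation w) = κ) :
    ∃ ρ : Measure ℝ≥0, SigmaFinite ρ ∧ κ.restrict {q | 0 < q.1} =
      ((ρ.prod (volume : Measure ℝ)).prod
        (volume : Measure (EuclideanSpace ℝ (Fin k)))).map (lightConeChart k) := by
  have hI := measurable_lightConeChartInv k
  have hC := measurable_lightConeChart k
  have hCI : ∀ᵐ q ∂(κ.restrict {q | 0 < q.1}), lightConeChart k (lightConeChartInv k q) = q := by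
    filter_upwards [ae_restrict_mem (measurableSet_fst_pos k), ae_restrict_of_ae hcone]
      with q hq h using lightConeChart_chartInv hq h
  set ν := (κ.restrict {q | 0 < q.1}).map (lightConeChartInv k) with hν
  have : SigmaFinite ν := sigmaFinite_map_of_leftInverse hI hC hCI
  -- A null rotation translates `y` by `u w = e^s w` and fixes mass and rapidity.
  obtain ⟨σ, hσ, hνσ⟩ := exists_eq_prod_of_scaled_translation_invariant (ν := ν)
    (volume : Measure (EuclideanSpace ℝ (Fin k))) (a := fun z : ℝ≥0 × ℝ => Real.exp z.2)
    (by fun_prop) (fun z => (Real.exp_pos _).ne') fun w => by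
      refine map_chartInv_eq (by fun_prop) (hnull w) (fun q => Iff.rfl) fun q hq => ?_
      refine Prod.ext (Prod.ext ?_ rfl) ?_
      · simp only [lightConeChartInv, nullRotation, LinearEquiv.coe_mk, LinearMap.coe_mk,
          AddHom.coe_mk]
        rw [norm_add_sq_real, norm_smul, Real.norm_eq_abs, mul_pow, sq_abs, real_inner_smul_left]
        congr 2
        ring
      · simp [lightConeChartInv, nullRotation, Real.exp_log hq]
  -- A boost shifts the rapidity by `t`; cancelling the Lebesgue factor in `y` passes this
  -- invariance on to `σ`.
  have hshift : ∀ t : ℝ, σ.map (fun z => (z.1, t + z.2)) = σ := fun t => by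
    have hinv : ν.map (fun z => ((z.1.1, t + z.1.2), z.2)) = ν := by
      refine map_chartInv_eq (by fun_prop) (hboost t)
        (fun q => mul_pos_iff_of_pos_left (Real.exp_pos t)) fun q hq => ?_
      have h : Real.exp t * Real.exp (-t) = 1 := by simp [← Real.exp_add]
      refine Prod.ext (Prod.ext ?_ ?_) rfl
      · simp only [lightConeChartInv, boost, LinearEquiv.coe_mk, LinearMap.coe_mk, AddHom.coe_mk]
        congr 3
        linear_combination -(q.1 * q.2.1) * h
      · simp [lightConeChartInv, boost, Real.log_mul (Real.exp_pos t).ne' hq.ne']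
    have hm : Measurable fun z : ℝ≥0 × ℝ => (z.1, t + z.2) := by fun_prop
    have hprod := Measure.map_prod_map σ (volume : Measure (EuclideanSpace ℝ (Fin k))) hm
      measurable_id
    rw [Measure.map_id, ← hνσ] at hprod
    refine prod_right_cancel (κ := (volume : Measure (EuclideanSpace ℝ (Fin k))))
      (measure_closedBall_ne_zero k) measure_closedBall_lt_top.ne ?_
    rw [hprod, ← hνσ]
    exact hinv
  obtain ⟨ρ, hρ, hσρ⟩ := exists_eq_prod_of_translation_invariant (volume : Measure ℝ) hshift
  refine ⟨ρ, hρ, ?_⟩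
  have hCI' : lightConeChart k ∘ lightConeChartInv k =ᵐ[κ.restrict {q | 0 < q.1}] id := hCI
  rw [← hσρ, ← hνσ, hν, Measure.map_map hC hI, Measure.map_congr hCI', Measure.map_id]

/-- The part of `∫ μ_m dρ(m)` in `{u > 0}`. -/
theorem restrict_fst_pos_massSuperposition (k : ℕ) (ρ : Measure ℝ≥0) [SigmaFinite ρ] :
    ((massSuperposition (k + 1) ρ).map (lightConeCoord k)).restrict {q | 0 < q.1} =
      ((ρ.prod (volume : Measure ℝ)).prod
        (volume : Measure (EuclideanSpace ℝ (Fin k)))).map (lightConeChart k) := by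
  refine Measure.ext_of_lintegral _ fun f hf => ?_
  have hC := measurable_lightConeChart k
  have hfC : Measurable fun z => f (lightConeChart k z) := hf.comp hC
  rw [← lintegral_indicator (measurableSet_fst_pos k),
    lintegral_map_massSuperposition ρ (hf.indicator (measurableSet_fst_pos k)),
    lintegral_map hf hC, lintegral_prod _ hfC.aemeasurable,
    lintegral_prod _ hfC.lintegral_prod_right'.aemeasurable]
  refine lintegral_congr fun m => ?_
  have hsw : Measurable fun z : ℝ × EuclideanSpace ℝ (Fin k) =>
      f (lightConeChart k ((m, z.1), z.2)) := hfC.comp (by fun_prop)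
  -- The hyperbola substitution is made at fixed `y`, so the rapidity must be the inner variable.
  conv_rhs => rw [lintegral_lintegral_swap hsw.aemeasurable]
  refine lintegral_congr fun y => ?_
  refine Eq.trans (lintegral_congr fun a => ?_)
    (lintegral_hyperbola (M := (m : ℝ) ^ 2 + ‖y‖ ^ 2) (by positivity) fun u v => f (u, v, y))
  by_cases ha : 0 < √((m : ℝ) ^ 2 + ‖y‖ ^ 2 + a ^ 2) + a <;> simp [ha]

/-- The swap is `a ↦ -a` in the longitudinal momentum, under which energy and Lebesgue measure are
unchanged. -/
theorem map_swap_massSuperposition (k : ℕ) (ρ : Measure ℝ≥0) :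
    ((massSuperposition (k + 1) ρ).map (lightConeCoord k)).map (lightConeSwap k) =
      (massSuperposition (k + 1) ρ).map (lightConeCoord k) := by
  have hS := measurable_lightConeSpace_linearEquiv (lightConeSwap k)
  refine Measure.ext_of_lintegral _ fun f hf => ?_
  have hfS : Measurable fun q => f (lightConeSwap k q) := hf.comp hS
  rw [lintegral_map hf hS, lintegral_map_massSuperposition ρ hfS,
    lintegral_map_massSuperposition ρ hf]
  refine lintegral_congr fun m => lintegral_congr fun y => ?_
  conv_rhs => rw [← lintegral_neg_eq_self]
  refine lintegral_congr fun a => ?_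
  simp [lightConeSwap, sub_eq_add_neg]

/-- If `a ≠ 0`, one of `p₀ + a`, `p₀ - a` is positive; the exceptional `a = 0` is Lebesgue null. -/
theorem massSuperposition_pos (k : ℕ) (ρ : Measure ℝ≥0) :
    ∀ᵐ q ∂(massSuperposition (k + 1) ρ).map (lightConeCoord k), 0 < q.1 ∨ 0 < q.2.1 := by
  have hm : MeasurableSet {q : LightConeSpace k | ¬(0 < q.1 ∨ 0 < q.2.1)} :=
    ((measurableSet_fst_pos k).union
      (measurableSet_lt measurable_const (measurable_fst.comp measurable_snd))).compl
  rw [ae_iff, ← lintegral_indicator_one hm,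
    lintegral_map_massSuperposition ρ (measurable_one.indicator hm)]
  refine lintegral_eq_zero_of_ae_eq_zero (.of_forall fun m => ?_)
  refine lintegral_eq_zero_of_ae_eq_zero (.of_forall fun y => ?_)
  refine lintegral_eq_zero_of_ae_eq_zero ?_
  filter_upwards [Measure.ae_ne volume (0 : ℝ)] with a ha
  have hr := Real.sqrt_nonneg ((m : ℝ) ^ 2 + ‖y‖ ^ 2 + a ^ 2)
  rw [indicator_of_notMem, mul_zero, Pi.zero_apply]
  simp only [mem_ofPred_eq, not_not]
  rcases lt_or_gt_of_ne ha with h | h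
  · right; linarith
  · left; linarith

/-- Almost every point outside `{u > 0}` has `v > 0`, and the swap carries it into `{u > 0}`, so the
restriction there determines the measure. -/
theorem measure_eq_of_restrict_fst_pos {κ τ : Measure (LightConeSpace k)}
    (hκ : κ.map (lightConeSwap k) = κ) (hτ : τ.map (lightConeSwap k) = τ)
    (hκp : ∀ᵐ q ∂κ, 0 < q.1 ∨ 0 < q.2.1) (hτp : ∀ᵐ q ∂τ, 0 < q.1 ∨ 0 < q.2.1)
    (h : κ.restrict {q | 0 < q.1} = τ.restrict {q | 0 < q.1}) : κ = τ := by
  have hS := measurable_lightConeSpace_linearEquiv (lightConeSwap k)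
  set U : Set (LightConeSpace k) := {q | 0 < q.1} with hU
  have hUm : MeasurableSet U := measurableSet_fst_pos k
  have key : ∀ ξ : Measure (LightConeSpace k), ξ.map (lightConeSwap k) = ξ →
      (∀ᵐ q ∂ξ, 0 < q.1 ∨ 0 < q.2.1) → ∀ A, MeasurableSet A →
      ξ A = ξ.restrict U A + ξ.restrict U (lightConeSwap k ⁻¹' (A \ U)) := by
    intro ξ hξ hp A hA
    have hA' : MeasurableSet (lightConeSwap k ⁻¹' (A \ U)) := hS (hA.diff hUm)
    rw [← measure_inter_add_sdiff A hUm, Measure.restrict_apply hA, Measure.restrict_apply hA']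
    congr 1
    conv_lhs => rw [← hξ, Measure.map_apply hS (hA.diff hUm)]
    refine measure_congr ?_
    filter_upwards [hp] with q hq
    refine propext ⟨fun hqA => ⟨hqA, hq.resolve_right fun hv => hqA.2 hv⟩, fun hqA => hqA.1⟩
  refine Measure.ext fun A hA => ?_
  rw [key κ hκ hκp A hA, key τ hτ hτp A hA, h]

end Chart

/-! ### Existence of the representation -/

section Existence

theorem exists_eq_massSuperposition_succ {k : ℕ} {μ : Measure (Momentum (k + 1))} [SigmaFinite μ]
    (hμ : IsLorentzInvariantOnCone μ) :
    ∃ ρ : Measure ℝ≥0, SigmaFinite ρ ∧ μ.restrict {0}ᶜ = massSuperposition (k + 1) ρ := by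
  have hL := measurable_lightConeCoord k
  have hL' := measurable_lightConeCoord_symm k
  set κ := μ.map (lightConeCoord k) with hκ
  have : SigmaFinite κ := sigmaFinite_map_of_leftInverse hL hL' (.of_forall fun p => by simp)
  have hcone : ∀ᵐ q ∂κ, 0 ≤ q.1 + q.2.1 ∧ ‖q.2.2‖ ^ 2 ≤ q.1 * q.2.1 := by
    have hm : MeasurableSet
        {q : LightConeSpace k | 0 ≤ q.1 + q.2.1 ∧ ‖q.2.2‖ ^ 2 ≤ q.1 * q.2.1} :=
      by
      rw [ofPred_and]
      exact (measurableSet_le (by fun_prop) (by fun_prop)).inter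
        (measurableSet_le (by fun_prop) (by fun_prop))
    rw [hκ, ae_map_iff hL.aemeasurable hm]
    filter_upwards [show ∀ᵐ p ∂μ, p ∈ closedForwardCone (k + 1) from hμ.1] with p hp
    obtain ⟨h0, h1⟩ := hp
    rw [lorentzForm_eq_lightConeForm, lightConeForm, real_inner_self_eq_norm_sq] at h1
    refine ⟨?_, by linarith⟩
    have : (lightConeCoord k p).1 + (lightConeCoord k p).2.1 = 2 * p.1 := by
      simp [lightConeCoord]; ring
    linarith
  have hboost : ∀ t, κ.map (boost k t) = κ := fun t =>
    hμ.map_lightCone (lightConeForm_boost t) (by simp [boost]; positivity)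
  have hnull : ∀ w : EuclideanSpace ℝ (Fin k), κ.map (nullRotation w) = κ := fun w =>
    hμ.map_lightCone (lightConeForm_nullRotation w) (by simp [nullRotation]; positivity)
  have hswap : κ.map (lightConeSwap k) = κ :=
    hμ.map_lightCone lightConeForm_swap (by simp [lightConeSwap])
  obtain ⟨ρ, hρ, hρU⟩ := exists_restrict_fst_pos_eq (hcone.mono fun q hq => hq.2) hboost hnull
  refine ⟨ρ, hρ, ?_⟩
  have h0m : MeasurableSet ({0}ᶜ : Set (LightConeSpace k)) := (measurableSet_singleton 0).compl
  have hS := measurable_lightConeSpace_linearEquiv (lightConeSwap k)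
  have key : κ.restrict {0}ᶜ = (massSuperposition (k + 1) ρ).map (lightConeCoord k) := by
    refine measure_eq_of_restrict_fst_pos ?_ (map_swap_massSuperposition k ρ) ?_
      (massSuperposition_pos k ρ) ?_
    · conv_rhs => rw [← hswap, Measure.restrict_map hS h0m]
      congr 2
      ext q
      simp
    · filter_upwards [ae_restrict_of_ae hcone, ae_restrict_mem h0m] with q hq hq0
      -- In the cone `u + v ≥ 0`, so `u, v ≤ 0` forces `u = v = 0`, then `y = 0`: only the origin
      -- escapes both half-spaces.
      by_contra! hneg
      have h1 : q.1 = 0 := by linarith [hq.1, hneg.1, hneg.2]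
      have h2 : q.2.1 = 0 := by linarith [hq.1, hneg.1, hneg.2]
      have h3 : ‖q.2.2‖ ^ 2 ≤ 0 := by simpa [h1] using hq.2
      have h4 : q.2.2 = 0 := by
        rw [← norm_eq_zero]
        exact pow_eq_zero_iff two_ne_zero |>.1 (le_antisymm h3 (by positivity))
      exact hq0 (Prod.ext h1 (Prod.ext h2 h4))
    · rw [restrict_fst_pos_massSuperposition, ← hρU,
        Measure.restrict_restrict (measurableSet_fst_pos k)]
      congr 1
      refine inter_eq_left.2 fun q hq h0 => ?_
      rw [mem_singleton_iff] at h0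
      simp [h0] at hq
  have hpre : lightConeCoord k ⁻¹' {0}ᶜ = {0}ᶜ := by
    ext p
    simp
  have hcancel : ∀ ξ : Measure (Momentum (k + 1)),
      (ξ.map (lightConeCoord k)).map (lightConeCoord k).symm = ξ := fun ξ => by
    rw [Measure.map_map hL' hL]
    convert Measure.map_id
    ext p : 1
    simp
  rw [hκ, Measure.restrict_map hL h0m, hpre] at key
  rw [← hcancel (μ.restrict _), key, hcancel]

/-- Here `μ_m` is a point mass of weight `1 / m` at `p₀ = m`, so `ρ` is `μ` off the origin
multiplied by `p₀`. Only the support condition enters. -/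
theorem exists_eq_massSuperposition_zero {μ : Measure (Momentum 0)} [SigmaFinite μ]
    (hμ : IsLorentzInvariantOnCone μ) :
    ∃ ρ : Measure ℝ≥0, SigmaFinite ρ ∧ ρ {0} = 0 ∧
      μ.restrict {0}ᶜ = massSuperposition 0 ρ := by
  have h0m : MeasurableSet ({0}ᶜ : Set (Momentum 0)) := (measurableSet_singleton 0).compl
  set κ := (μ.restrict {0}ᶜ).withDensity fun p => ENNReal.ofReal p.1 with hκ
  have hf : Measurable fun p : Momentum 0 => p.1.toNNReal := by fun_prop
  have hd : Measurable fun p : Momentum 0 => ENNReal.ofReal p.1 := by fun_prop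
  have hpos : ∀ᵐ p ∂(μ.restrict {0}ᶜ), 0 < p.1 := by
    filter_upwards [ae_restrict_mem h0m, ae_restrict_of_ae
      (show ∀ᵐ p ∂μ, p ∈ closedForwardCone 0 from hμ.1)] with p hp0 hp
    refine lt_of_le_of_ne hp.1 fun h => hp0 (Prod.ext h.symm (Subsingleton.elim _ _))
  have hposκ : ∀ᵐ p ∂κ, 0 < p.1 := (withDensity_absolutelyContinuous _ _).ae_le hpos
  refine ⟨κ.map fun p => p.1.toNNReal, ?_, ?_, ?_⟩
  · refine sigmaFinite_map_of_leftInverse (g := fun m : ℝ≥0 => ((m : ℝ), 0)) hf (by fun_prop) ?_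
    filter_upwards [hposκ] with p hp
    exact Prod.ext (Real.coe_toNNReal _ hp.le) (Subsingleton.elim _ _)
  · rw [Measure.map_apply hf (measurableSet_singleton 0)]
    refine measure_mono_null ?_ hposκ
    intro p hp
    simpa using hp
  · refine Measure.ext_of_lintegral _ fun f hfm => ?_
    have hfE : ∀ m : ℝ≥0, ∫⁻ x : EuclideanSpace ℝ (Fin 0),
        shellDensity m x * f (shellEnergy m x, x) = (m : ℝ≥0∞)⁻¹ * f ((m : ℝ), 0) := by
      intro m
      have hE : shellEnergy m (0 : EuclideanSpace ℝ (Fin 0)) = m := by simp [shellEnergy]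
      rw [volume_euclideanSpace_eq_dirac, lintegral_dirac, shellDensity, hE,
        ENNReal.ofReal_coe_nnreal]
    have hG : Measurable fun m : ℝ≥0 => (m : ℝ≥0∞)⁻¹ * f ((m : ℝ), 0) :=
      Measurable.mul (by fun_prop) (hfm.comp (by fun_prop))
    rw [lintegral_massSuperposition _ hfm]
    simp_rw [hfE]
    have hGf : Measurable fun p : Momentum 0 =>
        (p.1.toNNReal : ℝ≥0∞)⁻¹ * f ((p.1.toNNReal : ℝ), 0) := hG.comp hf
    rw [lintegral_map hG hf, hκ, lintegral_withDensity_eq_lintegral_mul _ hd hGf]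
    refine lintegral_congr_ae ?_
    filter_upwards [hpos] with p hp
    have hp' : ((p.1.toNNReal : ℝ), (0 : EuclideanSpace ℝ (Fin 0))) = p :=
      Prod.ext (Real.coe_toNNReal _ hp.le) (Subsingleton.elim _ _)
    simp only [Pi.mul_apply, hp']
    rw [← mul_assoc, ← ENNReal.ofReal, ENNReal.mul_inv_cancel (by simpa using hp)
      ENNReal.ofReal_ne_top, one_mul]

theorem exists_isSpectralRepresentation {n : ℕ} {μ : Measure (Momentum n)} [SigmaFinite μ]
    (hμ : IsLorentzInvariantOnCone μ) :
    ∃ (c : ℝ≥0) (ρ : Measure ℝ≥0), IsSpectralRepresentation μ c ρ := by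
  -- `σ`-finiteness makes the mass at the origin finite, so it can serve as `c`.
  have hc : ((μ {0}).toNNReal : ℝ≥0) • Measure.dirac 0 = μ.restrict {0} := by
    rw [Measure.restrict_singleton, ENNReal.smul_def, ENNReal.coe_toNNReal
      measure_singleton_lt_top.ne]
  have hsplit : ∀ ρ, μ.restrict {0}ᶜ = massSuperposition n ρ →
      μ = (μ {0}).toNNReal • Measure.dirac 0 + massSuperposition n ρ := fun ρ hρ => by
    rw [hc, ← hρ, Measure.restrict_add_restrict_compl (measurableSet_singleton 0)]
  cases n with
  | zero =>
    obtain ⟨ρ, hρ, h0, h⟩ := exists_eq_massSuperposition_zero hμ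
    exact ⟨_, ρ, hρ, fun _ => h0, hsplit ρ h⟩
  | succ k =>
    obtain ⟨ρ, hρ, h⟩ := exists_eq_massSuperposition_succ hμ
    exact ⟨_, ρ, hρ, fun h => absurd h (Nat.succ_ne_zero k), hsplit ρ h⟩

end Existence

end

/-- The dimension is `d = n + 1 ≥ 1`. In (C3) the logarithm is extended by `ln(1/0) = ∞`. -/
theorem theoremB1 (n : ℕ) (μ : Measure (Momentum n)) [SigmaFinite μ]
    (hμ : IsLorentzInvariantOnCone μ) :
    (∃ (c : ℝ≥0) (ρ : Measure ℝ≥0), IsSpectralRepresentation μ c ρ) ∧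
    ∀ (c : ℝ≥0) (ρ : Measure ℝ≥0), IsSpectralRepresentation μ c ρ →
      -- (a)
      ((μ.HasTemperateGrowth ↔
          IsTemperedOnHalfLine ρ ∧
          (n = 0 → ∫⁻ m in Iic 1, (m : ℝ≥0∞)⁻¹ ∂ρ < ∞) ∧
          (n = 1 → ∫⁻ m in Iic 1, (ENNReal.log (m : ℝ≥0∞)⁻¹).toENNReal ∂ρ < ∞)) ∧
        (n = 1 → ∫⁻ m in Iic 1, (ENNReal.log (m : ℝ≥0∞)⁻¹).toENNReal ∂ρ < ∞ → ρ {0} = 0)) ∧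
      -- (b)
      ((spatialProjection μ).HasTemperateGrowth ↔
          μ.HasTemperateGrowth ∧ ∫⁻ m in Ici 1, (m : ℝ≥0∞)⁻¹ ∂ρ < ∞) ∧
      (¬ ∫⁻ m in Ici 1, (m : ℝ≥0∞)⁻¹ ∂ρ < ∞ →
        IsZeroInftyWithTrivialL2 (spatialProjection (massSuperposition n ρ)) ∧
        (c = 0 ∨ n = 0 → IsZeroInftyWithTrivialL2 (spatialProjection μ))) := by
  refine ⟨exists_isSpectralRepresentation hμ, fun c ρ h => ?_⟩
  have := h.1
  refine ⟨⟨?_, fun _ => measure_singleton_zero_eq_zero_of_log⟩, ?_, fun hinf =>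
    ⟨isZeroInfty_spatialProjection_massSuperposition hinf, isZeroInfty_spatialProjection h hinf⟩⟩
  · rw [h.hasTemperateGrowth_iff, exists_lintegral_shellIntegral_lt_top_iff]
  · rw [h.hasTemperateGrowth_spatialProjection_iff, h.hasTemperateGrowth_iff,
      exists_lintegral_spatialIntegral_lt_top_iff]
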